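/- Let $d\in\{2,3\}$ and let $\theta_0\in L^2(\mathbb{R}^d)$ be real-valued with decay character $r^*$, $-\frac d2<r^*<1$; that is, the limit $$\lim_{\delta\to0^+}\delta^{-2r^*-d}\int_{|\xi|\le\delta}|\widehat{\theta_0}(\xi)|^2\,d\xi$$ exists and lies in $(0,\infty)$. Let $\alpha>\frac{r^*}{2}+\frac12$ and $A\in\mathbb{R}$. Then there is a constant $C>0$, depending only on $d,\theta_0,r^*,\alpha$ and $A$, such that the following holds for every $\kappa>0$. Let $u$ be a time-dependent vector field on $\mathbb{R}^d\times(0,\infty)$, measurable in $(x,t)$, with $u(t)\in L^2(\mathbb{R}^d)$ and $\nabla\cdot u(t)=0$ (in the sense of distributions) for almost every $t>0$, and with $\|u(t)\|_2\sim(1+t)^{-\alpha}$, in the sense that for some $a>0$ one has $a(1+t)^{-\alpha}\le\|u(t)\|_2\le A(1+t)^{-\alpha}$ for almost every $t>0$. Let $\theta$ be a weak solution, in the class $L^\infty_{loc}([0,\infty);L^2(\mathbb{R}^d))\cap L^2_{loc}([0,\infty);H^1(\mathbb{R}^d))$ (taken in its representative that is weakly continuous in time), of $$\partial_t\theta+u\cdot\nabla\theta-\kappa\Delta\theta=0\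 \text{ in }\mathbb{R}^d\times(0,\infty),\qquad \theta(\cdot,0)=\theta_0 .$$ If $t>0$ is so large that, for some rational number $m\ge d+2$, either $$\alpha\ge\tfrac32-\tfrac{r^*}{2}\quad\text{and}\quad(1+t)^{r^*-1}\le\kappa^{m+\frac12-\frac d4-r^*},$$ or $$\tfrac{r^*}{2}+\tfrac12<\alpha\le\tfrac32-\tfrac{r^*}{2}\quad\text{and}\quad(1+t)^{\frac{r^*}{2}-\alpha+\frac12}\le\kappa^{m+\frac12-\frac d4-r^*},$$ then $$\|\theta(t)\|_2\ge C\,\kappa^{-\frac d4-\frac{r^*}{2}}(1+t)^{-\frac d4-\frac{r^*}{2}} .$$ -/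

import Mathlib

open MeasureTheory Set Filter Topology
open scoped ContDiff Gradient Laplacian FourierTransform RealInnerProductSpace

noncomputable section

namespace AdvDiff

/-- The Euclidean space `ℝ^d`. -/
abbrev Rd (d : ℕ) : Type := EuclideanSpace ℝ (Fin d)

/-- The `L²` norm `(∫ |f|²)^{1/2}` over `ℝ^d` (used for functions in `L²` only). -/
def l2Norm {d : ℕ} {F : Type*} [NormedAddCommGroup F] (f : Rd d → F) : ℝ :=
  (eLpNorm f 2 volume).toReal

/-- Test functions: the elements of `C_c^∞(ℝ^d)`. -/
structure IsTestFunction {d : ℕ} (ψ : Rd d → ℝ) : Prop where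
  smooth : ContDiff ℝ ∞ ψ
  compact : HasCompactSupport ψ

/-- `G` is the weak (distributional) gradient of `f`. -/
def IsWeakGradient {d : ℕ} (f : Rd d → ℝ) (G : Rd d → Rd d) : Prop :=
  ∀ ψ : Rd d → ℝ, IsTestFunction ψ →
    ∫ x, f x • (∇ ψ) x = - ∫ x, ψ x • G x

/-- `∇ · v = 0` in the sense of distributions. -/
def IsDivergenceFree {d : ℕ} (v : Rd d → Rd d) : Prop :=
  ∀ ψ : Rd d → ℝ, IsTestFunction ψ → ∫ x, ⟪v x, (∇ ψ) x⟫ = 0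

/-- The `L²` Fourier transform of a real-valued square-integrable function on `ℝ^d`,
in Mathlib's normalization `∫ e^{-2πi ξ·x} f(x) dx`. -/
def fourierL2 {d : ℕ} (f : Rd d → ℝ) (hf : MemLp f 2 volume) : Rd d → ℂ :=
  (𝓕 (MemLp.toLp (fun x => (f x : ℂ)) hf.ofReal : Lp ℂ 2 (volume : Measure (Rd d))) :
    Lp ℂ 2 (volume : Measure (Rd d)))

/-- `f ∈ L²(ℝ^d)` has decay character `r`: `r ∈ (-d/2, ∞)` and
`δ^{-2r-d} ∫_{|ξ| ≤ δ} |f̂(ξ)|² dξ` has a limit in `(0, ∞)` as `δ → 0+`.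
At most one `r` has this property, and which one it is does not depend on the normalization of the
Fourier transform (a dilation in `ξ` only multiplies the limit by a positive constant). -/
def HasDecayCharacter {d : ℕ} (f : Rd d → ℝ) (hf : MemLp f 2 volume) (r : ℝ) : Prop :=
  -(d : ℝ) / 2 < r ∧
    ∃ L : ℝ, 0 < L ∧
      Tendsto (fun δ : ℝ => δ ^ (-2 * r - d) *
        ∫ ξ in Metric.closedBall (0 : Rd d) δ, ‖fourierL2 f hf ξ‖ ^ 2) (𝓝[>] 0) (𝓝 L)

/-- A time-dependent divergence-free velocity field on `ℝ^d × (0, ∞)`, square-integrable in space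
at (almost) every time. -/
structure IsVelocityField {d : ℕ} (u : ℝ → Rd d → Rd d) : Prop where
  measurable : AEStronglyMeasurable (fun p : ℝ × Rd d => u p.1 p.2)
    ((volume.restrict (Ioi 0)).prod volume)
  memLp : ∀ᵐ t ∂(volume.restrict (Ioi (0 : ℝ))), MemLp (u t) 2 volume
  divergence_free : ∀ᵐ t ∂(volume.restrict (Ioi (0 : ℝ))), IsDivergenceFree (u t)

/-- `‖u(t)‖₂ ∼ (1 + t)^{-α}`: two-sided comparison at (almost) every time, with upper
constant `A` and some positive lower constant. -/
def HasEnergyDecay {d : ℕ} (u : ℝ → Rd d → Rd d) (α A : ℝ) : Prop :=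
  ∃ a : ℝ, 0 < a ∧ ∀ᵐ t ∂(volume.restrict (Ioi (0 : ℝ))),
    a * (1 + t) ^ (-α) ≤ l2Norm (u t) ∧ l2Norm (u t) ≤ A * (1 + t) ^ (-α)

/-- `θ` is a weak solution of `∂ₜθ + u · ∇θ - κ Δθ = 0` on `ℝ^d × (0, ∞)` with `θ(0) = θ₀`
(for a divergence-free `u`), in the energy class
`L^∞_loc([0,∞); L²) ∩ L²_loc([0,∞); H¹)`. The equation is written in its time-integrated form,
tested with functions of `x`; this fixes the representative of `θ` that is defined at every time
`t ≥ 0` and weakly continuous in time. -/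
structure IsWeakSolution {d : ℕ} (κ : ℝ) (u : ℝ → Rd d → Rd d) (θ₀ : Rd d → ℝ)
    (θ : ℝ → Rd d → ℝ) : Prop where
  measurable : AEStronglyMeasurable (fun p : ℝ × Rd d => θ p.1 p.2)
    ((volume.restrict (Ioi 0)).prod volume)
  memLp : ∀ t : ℝ, 0 ≤ t → MemLp (θ t) 2 volume
  bounded : ∀ T : ℝ, 0 < T → ∃ M : ℝ, ∀ t ∈ Icc 0 T, l2Norm (θ t) ≤ M
  gradient : ∃ G : ℝ → Rd d → Rd d,
    (∀ T : ℝ, 0 < T →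
      MemLp (fun p : ℝ × Rd d => G p.1 p.2) 2 ((volume.restrict (Ioc 0 T)).prod volume)) ∧
    ∀ᵐ t ∂(volume.restrict (Ioi (0 : ℝ))), IsWeakGradient (θ t) (G t)
  equation : ∀ t : ℝ, 0 ≤ t → ∀ ψ : Rd d → ℝ, IsTestFunction ψ →
    ∫ x, θ t x * ψ x = (∫ x, θ₀ x * ψ x) +
      ∫ s in (0 : ℝ)..t, ∫ x, θ s x * (κ * (Δ ψ) x + ⟪u s x, (∇ ψ) x⟫)

/-- The largeness condition on the time `t`, with exponent parameter `m`. -/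
def TimeLarge (d : ℕ) (r α κ m t : ℝ) : Prop :=
  (3 / 2 - r / 2 ≤ α ∧
    (1 + t) ^ (r - 1) ≤ κ ^ (m + 1 / 2 - (d : ℝ) / 4 - r)) ∨
  (r / 2 + 1 / 2 < α ∧ α ≤ 3 / 2 - r / 2 ∧
    (1 + t) ^ (r / 2 - α + 1 / 2) ≤ κ ^ (m + 1 / 2 - (d : ℝ) / 4 - r))

end AdvDiff

end

/-!
The lower bound is carried by the low frequencies of `θ`. Diffusion up to time `t` barely acts on
frequencies `|ξ| ≤ ρ` with `ρ = ε (κ (1 + t)) ^ (-1/2)`, so on them `θ(t)` keeps most of the mass of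
the datum, up to what the transport term moves. By the decay character that mass has square root
of size `ρ ^ (d/2 + r)`, which is the claimed bound. The transport term is a divergence, so tested
with a function of frequencies below `ρ` it costs a factor `ρ · |B_ρ| ^ (1/2) ~ ρ ^ (1 + d/2)` times
`∫₀ᵗ ‖u(s)‖ ‖θ(s)‖ ds`. With `‖θ(s)‖ ≤ ‖θ₀‖` and the decay of `u`, the largeness condition on `t`
makes this at most a constant times `ε ^ (1 - r) ρ ^ (d/2 + r)`, which is absorbed for small `ε`;
`ε` does not depend on `κ` or `u`.

Two facts are needed about weak solutions whose velocity is only square-integrable in space.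

* The energy inequality `IsWeakSolution.l2Norm_le`. As `u · ∇θ` is not in the dual of the energy
  space, `θ` cannot be used as a test function. The solution is mollified and renormalized by the
  truncated square `N √(N² + x²) - N²`, which is convex (so diffusion has a sign) with bounded
  derivative (so the commutator of mollification with `u · ∇`, which is small in `L¹`, is
  harmless). Then the mollification, a spatial cut-off and `N` are removed in this order.
* Low-frequency stability, `IsWeakSolution.low_frequency_lower_bound`. Instead of a Fourier
  transform of the equation, the solution is paired with band-limited Schwartz functions `f`, for
  which `‖Δ f‖ ≤ (2πρ)² ‖f‖` and `‖∇ f‖_∞ ≤ 2πρ |B_ρ| ^ (1/2) ‖f‖`. Since `Δ f` is again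
  band-limited, the best constant in the bound for the change of these pairings controls itself.

`exists_bandLimited_pairing` turns the low-frequency mass of `θ₀` into a pairing, and
`IsWeakSolution.rpow_le_l2Norm` combines everything at the scale `ρ`.
-/

noncomputable section

namespace AdvDiff

open scoped Convolution SchwartzMap LineDeriv
open ContinuousLinearMap (lsmul)

/-! ### Mollification in `L^p` -/

/-- Convolution with the `L¹`-normalized bump function `φ`. -/
def mollify {d : ℕ} {F : Type*} [NormedAddCommGroup F] [NormedSpace ℝ F]
    (φ : ContDiffBump (0 : Rd d)) (f : Rd d → F) : Rd d → F :=
  φ.normed volume ⋆[lsmul ℝ ℝ, volume] f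

section Mollify

variable {d : ℕ} {F : Type*} [NormedAddCommGroup F] [NormedSpace ℝ F]

lemma mollify_apply (φ : ContDiffBump (0 : Rd d)) (f : Rd d → F) (x : Rd d) :
    mollify φ f x = ∫ y, φ.normed volume (x - y) • f y := by
  simp only [mollify, convolution_lsmul_swap]

/-- Convolution with a probability density does not increase `L^p` norms. -/
lemma eLpNorm_mollify_le (φ : ContDiffBump (0 : Rd d)) {p : ENNReal} (hp : 1 ≤ p) (hp' : p ≠ ⊤)
    {f : Rd d → F} (hf : AEStronglyMeasurable f volume) :
    eLpNorm (mollify φ f) p volume ≤ eLpNorm f p volume := by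
  set η := φ.normed (volume : Measure (Rd d)) with hη
  have hηc : Continuous η := φ.continuous_normed
  set μ : Measure (Rd d) := volume.withDensity (fun t => ‖η t‖ₑ) with hμ
  have hprob : IsProbabilityMeasure μ := by
    refine ⟨?_⟩
    rw [hμ, withDensity_apply _ MeasurableSet.univ, setLIntegral_univ]
    have : ∀ t, ‖η t‖ₑ = ENNReal.ofReal (η t) := fun t =>
      Real.enorm_of_nonneg (φ.nonneg_normed t)
    simp_rw [this]
    rw [← ofReal_integral_eq_lintegral_ofReal φ.integrable_normed
      (Eventually.of_forall φ.nonneg_normed), φ.integral_normed, ENNReal.ofReal_one]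
  have hac : μ ≪ volume := withDensity_absolutelyContinuous _ _
  have hp0 : p ≠ 0 := (zero_lt_one.trans_le hp).ne'
  have hpr : 0 < p.toReal := ENNReal.toReal_pos hp0 hp'
  have hjm : AEStronglyMeasurable (fun z : Rd d × Rd d => f (z.1 - z.2))
      ((volume : Measure (Rd d)).prod μ) := by
    have h1 : AEStronglyMeasurable (fun z : Rd d × Rd d => f (z.1 - z.2))
      ((volume : Measure (Rd d)).prod volume) :=
        hf.comp_quasiMeasurePreserving (quasiMeasurePreserving_sub volume volume)
    exact h1.mono_ac (Measure.AbsolutelyContinuous.rfl.prod hac)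
  have hpt : ∀ x, ‖mollify φ f x‖ₑ ^ p.toReal ≤ ∫⁻ t, ‖f (x - t)‖ₑ ^ p.toReal ∂μ := by
    intro x
    have hfx : AEStronglyMeasurable (fun t => f (x - t)) μ :=
      (hf.comp_quasiMeasurePreserving (quasiMeasurePreserving_sub_left volume x)).mono_ac hac
    have h1 : ‖mollify φ f x‖ₑ ≤ eLpNorm (fun t => f (x - t)) 1 μ := by
      rw [eLpNorm_one_eq_lintegral_enorm, hμ,
        lintegral_withDensity_eq_lintegral_mul_non_measurable]
      · rw [mollify, convolution_lsmul]
        refine (enorm_integral_le_lintegral_enorm _).trans (le_of_eq ?_)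
        simp only [enorm_smul, Pi.mul_apply, hη]
      · exact hηc.enorm.measurable
      · exact Eventually.of_forall fun _ => enorm_lt_top
    have h2 := h1.trans (eLpNorm_le_eLpNorm_of_exponent_le hp hfx)
    rw [eLpNorm_eq_lintegral_rpow_enorm_toReal hp0 hp'] at h2
    calc ‖mollify φ f x‖ₑ ^ p.toReal ≤ _ := ENNReal.rpow_le_rpow h2 hpr.le
      _ = _ := by rw [← ENNReal.rpow_mul, one_div, inv_mul_cancel₀ hpr.ne', ENNReal.rpow_one]
  rw [eLpNorm_eq_lintegral_rpow_enorm_toReal hp0 hp',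
    eLpNorm_eq_lintegral_rpow_enorm_toReal hp0 hp']
  refine ENNReal.rpow_le_rpow ?_ (by positivity)
  calc ∫⁻ x, ‖mollify φ f x‖ₑ ^ p.toReal ≤ ∫⁻ x, ∫⁻ t, ‖f (x - t)‖ₑ ^ p.toReal ∂μ :=
        lintegral_mono hpt
    _ = ∫⁻ t, (∫⁻ x, ‖f (x - t)‖ₑ ^ p.toReal) ∂μ :=
        lintegral_lintegral_swap (hjm.enorm.pow_const _)
    _ = ∫⁻ _, (∫⁻ x, ‖f x‖ₑ ^ p.toReal) ∂μ := by
        congr 1; ext t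
        exact lintegral_sub_right_eq_self (fun x => ‖f x‖ₑ ^ p.toReal) t
    _ = _ := by simp

lemma continuous_mollify (φ : ContDiffBump (0 : Rd d)) {f : Rd d → F}
    (hf : LocallyIntegrable f volume) : Continuous (mollify φ f) :=
  φ.hasCompactSupport_normed.continuous_convolution_left _ φ.continuous_normed hf

lemma contDiff_mollify (φ : ContDiffBump (0 : Rd d)) {f : Rd d → F}
    (hf : LocallyIntegrable f volume) : ContDiff ℝ ∞ (mollify φ f) :=
  φ.hasCompactSupport_normed.contDiff_convolution_left (n := (⊤ : ℕ∞)) _ φ.contDiff_normed hf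

lemma memLp_mollify (φ : ContDiffBump (0 : Rd d)) {p : ENNReal} (hp : 1 ≤ p) (hp' : p ≠ ⊤)
    {f : Rd d → F} (hf : MemLp f p volume) : MemLp (mollify φ f) p volume :=
  ⟨(continuous_mollify φ (hf.locallyIntegrable hp)).aestronglyMeasurable,
    (eLpNorm_mollify_le φ hp hp' hf.1).trans_lt hf.2⟩

lemma convolutionExistsAt_normed (φ : ContDiffBump (0 : Rd d)) {f : Rd d → F}
    (hf : LocallyIntegrable f volume) (x : Rd d) :
    ConvolutionExistsAt (φ.normed volume) f x (lsmul ℝ ℝ) volume :=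
  φ.hasCompactSupport_normed.convolutionExists_left _ φ.continuous_normed hf x

lemma mollify_sub (φ : ContDiffBump (0 : Rd d)) {f g : Rd d → F}
    (hf : LocallyIntegrable f volume) (hg : LocallyIntegrable g volume) :
    mollify φ (f - g) = mollify φ f - mollify φ g := by
  ext x
  have hf' := (convolutionExistsAt_normed φ hf x).integrable_swap
  have hg' := (convolutionExistsAt_normed φ hg x).integrable_swap
  simp only [Pi.sub_apply, mollify_apply, smul_sub]
  exact integral_sub hf' hg'

/-- `L^p` convergence of mollifications for continuous compactly supported functions. -/
lemma tendsto_eLpNorm_mollify_sub_of_continuous [CompleteSpace F] {φ : ℕ → ContDiffBump (0 : Rd d)}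
    (hφ : Tendsto (fun n => (φ n).rOut) atTop (𝓝 0)) {p : ENNReal} (hp' : p ≠ ⊤)
    {g : Rd d → F} (hg : Continuous g) (hgs : HasCompactSupport g) :
    Tendsto (fun n => eLpNorm (mollify (φ n) g - g) p volume) atTop (𝓝 0) := by
  set K := Metric.cthickening 1 (tsupport g) with hK
  have hKc : IsCompact K := hgs.isCompact.cthickening
  have huc := hgs.uniformContinuous_of_continuous hg
  rw [ENNReal.tendsto_atTop_zero]
  intro ε hε
  obtain ⟨c, hc0, hc⟩ : ∃ c : ℝ, 0 < c ∧
      ENNReal.ofReal c * volume K ^ (1 / p.toReal) ≤ ε := by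
    have hfin : volume K ^ (1 / p.toReal) ≠ ⊤ :=
      ENNReal.rpow_ne_top_of_nonneg (by positivity) hKc.measure_lt_top.ne
    have ht : Tendsto (fun c : ℝ => ENNReal.ofReal c * volume K ^ (1 / p.toReal)) (𝓝[>] 0)
        (𝓝 0) := by
      have h0 : Tendsto (fun c : ℝ => ENNReal.ofReal c) (𝓝[>] 0) (𝓝 (ENNReal.ofReal 0)) :=
        (ENNReal.continuous_ofReal.tendsto 0).mono_left nhdsWithin_le_nhds
      simpa using ENNReal.Tendsto.mul_const h0 (Or.inr hfin)
    have hev := (ht.eventually (Iic_mem_nhds hε)).and self_mem_nhdsWithin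
    obtain ⟨c, h1, h2⟩ := hev.exists
    exact ⟨c, h2, h1⟩
  obtain ⟨δ, hδ, hgδ⟩ := Metric.uniformContinuous_iff.1 huc c hc0
  obtain ⟨N, hN⟩ := eventually_atTop.1
    ((hφ.eventually (Iio_mem_nhds hδ)).and (hφ.eventually (Iio_mem_nhds one_pos)))
  refine ⟨N, fun n hn => ?_⟩
  obtain ⟨h1, h2⟩ := hN n hn
  refine (eLpNorm_sub_le_of_dist_bdd volume hp' hKc.measurableSet hc0.le ?_ ?_ ?_).trans hc
  · intro x
    exact (φ n).dist_normed_convolution_le hg.aestronglyMeasurable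
      fun y hy => (hgδ (lt_trans hy h1)).le
  · refine (support_convolution_subset _).trans ?_
    rintro _ ⟨a, ha, b, hb, rfl⟩
    rw [(φ n).support_normed_eq] at ha
    refine Metric.mem_cthickening_of_dist_le _ b _ _ (subset_tsupport _ hb) ?_
    simpa [dist_eq_norm] using (lt_trans (mem_ball_zero_iff.1 ha) h2).le
  · exact (subset_tsupport _).trans (Metric.self_subset_cthickening _)

/-- Mollifications of an `L^p` function converge to it in `L^p`. -/
lemma tendsto_eLpNorm_mollify_sub [CompleteSpace F] {φ : ℕ → ContDiffBump (0 : Rd d)}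
    (hφ : Tendsto (fun n => (φ n).rOut) atTop (𝓝 0)) {p : ENNReal} (hp : 1 ≤ p) (hp' : p ≠ ⊤)
    {f : Rd d → F} (hf : MemLp f p volume) :
    Tendsto (fun n => eLpNorm (mollify (φ n) f - f) p volume) atTop (𝓝 0) := by
  rw [ENNReal.tendsto_atTop_zero]
  intro ε hε
  obtain ⟨δ, hδ0, hδ⟩ : ∃ δ : ENNReal, δ ≠ 0 ∧ δ + δ + δ ≤ ε := by
    refine ⟨ε / 3, (ENNReal.div_pos hε.ne' (by simp)).ne', ?_⟩
    rw [ENNReal.add_thirds]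
  obtain ⟨g, hgs, hgf, hgc, hgL⟩ := hf.exists_hasCompactSupport_eLpNorm_sub_le hp' hδ0
  obtain ⟨N, hN⟩ := ENNReal.tendsto_atTop_zero.1
    (tendsto_eLpNorm_mollify_sub_of_continuous hφ hp' hgc hgs) δ (pos_iff_ne_zero.2 hδ0)
  refine ⟨N, fun n hn => ?_⟩
  have hfl := hf.locallyIntegrable hp
  have hgl := hgL.locallyIntegrable hp
  have hdec : mollify (φ n) f - f = mollify (φ n) (f - g) + (mollify (φ n) g - g) + (g - f) := by
    rw [mollify_sub _ hfl hgl]; abel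
  have hm1 := (memLp_mollify (φ n) hp hp' (hf.sub hgL)).1
  have hm2 := ((memLp_mollify (φ n) hp hp' hgL).sub hgL).1
  calc eLpNorm (mollify (φ n) f - f) p volume
      ≤ eLpNorm (mollify (φ n) (f - g)) p volume + eLpNorm (mollify (φ n) g - g) p volume
        + eLpNorm (g - f) p volume := by
        rw [hdec]
        refine (eLpNorm_add_le (hm1.add hm2) (hgL.sub hf).1 hp).trans ?_
        gcongr
        exact eLpNorm_add_le hm1 hm2 hp
    _ ≤ δ + δ + δ := by
        gcongr
        · exact (eLpNorm_mollify_le _ hp hp' (hf.sub hgL).1).trans hgf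
        · exact hN n hn
        · rwa [eLpNorm_sub_comm]
    _ ≤ ε := hδ

end Mollify

/-! ### Gradients, Laplacians and weak gradients -/

section Calculus

variable {d : ℕ}

lemma gradient_mul {f g : Rd d → ℝ} {x : Rd d} (hf : DifferentiableAt ℝ f x)
    (hg : DifferentiableAt ℝ g x) :
    (∇ (fun y => f y * g y)) x = f x • (∇ g) x + g x • (∇ f) x := by
  simp only [gradient, fderiv_fun_mul hf hg, map_add, map_smulₛₗ, conj_trivial]

lemma gradient_comp_real {b : ℝ → ℝ} {f : Rd d → ℝ} {x : Rd d} (hb : DifferentiableAt ℝ b (f x))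
    (hf : DifferentiableAt ℝ f x) : (∇ (fun y => b (f y))) x = deriv b (f x) • (∇ f) x := by
  have h := (hb.hasDerivAt.comp_hasFDerivAt x hf.hasFDerivAt).fderiv
  simp only [gradient]
  rw [show (fun y => b (f y)) = b ∘ f from rfl, h, map_smulₛₗ, conj_trivial]

lemma norm_gradient (f : Rd d → ℝ) (x : Rd d) : ‖(∇ f) x‖ = ‖fderiv ℝ f x‖ := by
  simp [gradient]

lemma continuous_gradient {f : Rd d → ℝ} (hf : ContDiff ℝ 1 f) : Continuous (∇ f) :=
  (InnerProductSpace.toDual ℝ (Rd d)).symm.continuous.comp (hf.continuous_fderiv one_ne_zero)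

lemma laplacian_eq_sum_fderiv {f : Rd d → ℝ} (hf : ContDiff ℝ 2 f) (x : Rd d) :
    (Δ f) x = ∑ i, fderiv ℝ (fun z => fderiv ℝ f z (EuclideanSpace.basisFun (Fin d) ℝ i)) x
      (EuclideanSpace.basisFun (Fin d) ℝ i) := by
  rw [InnerProductSpace.laplacian_eq_iteratedFDeriv_orthonormalBasis f
    (EuclideanSpace.basisFun (Fin d) ℝ)]
  refine Finset.sum_congr rfl fun i _ => ?_
  have hd : DifferentiableAt ℝ (fderiv ℝ f) x :=
    (hf.fderiv_right (m := 1) (by norm_num)).differentiable one_ne_zero x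
  rw [iteratedFDeriv_two_apply, fderiv_clm_apply hd (by fun_prop)]
  simp

lemma continuous_laplacian {f : Rd d → ℝ} (hf : ContDiff ℝ 2 f) : Continuous (Δ f) := by
  have : Δ f = fun x => ∑ i, fderiv ℝ
      (fun z => fderiv ℝ f z (EuclideanSpace.basisFun (Fin d) ℝ i)) x
      (EuclideanSpace.basisFun (Fin d) ℝ i) := funext (laplacian_eq_sum_fderiv hf)
  rw [this]
  refine continuous_finsetSum _ fun i _ => ?_
  have h1 : ContDiff ℝ 1 (fun z => fderiv ℝ f z (EuclideanSpace.basisFun (Fin d) ℝ i)) :=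
    (hf.fderiv_right (m := 1) (by norm_num)).clm_apply contDiff_const
  exact (h1.continuous_fderiv one_ne_zero).clm_apply continuous_const

namespace IsTestFunction

variable {ψ : Rd d → ℝ}

lemma contDiff (h : IsTestFunction ψ) {n : ℕ∞} : ContDiff ℝ n ψ :=
  h.smooth.of_le (by exact_mod_cast le_top)

lemma continuous (h : IsTestFunction ψ) : Continuous ψ := h.smooth.continuous

lemma differentiable (h : IsTestFunction ψ) : Differentiable ℝ ψ :=
  h.smooth.differentiable (by simp)

lemma fderiv_apply (h : IsTestFunction ψ) (e : Rd d) :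
    IsTestFunction (fun x => fderiv ℝ ψ x e) where
  smooth := (h.smooth.fderiv_right (m := ∞) (by simp)).clm_apply contDiff_const
  compact := h.compact.fderiv_apply ℝ e

lemma continuous_gradient (h : IsTestFunction ψ) : Continuous (∇ ψ) :=
  AdvDiff.continuous_gradient (h.contDiff (n := 1))

lemma hasCompactSupport_gradient (h : IsTestFunction ψ) : HasCompactSupport (∇ ψ) :=
  (h.compact.fderiv (𝕜 := ℝ)).comp_left (map_zero _)

lemma continuous_laplacian (h : IsTestFunction ψ) : Continuous (Δ ψ) :=
  AdvDiff.continuous_laplacian (h.contDiff (n := 2))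

lemma hasCompactSupport_laplacian (h : IsTestFunction ψ) : HasCompactSupport (Δ ψ) := by
  refine h.compact.mono' ?_
  intro x hx
  by_contra hx'
  refine hx ?_
  rw [(InnerProductSpace.laplacian_congr_nhds (notMem_tsupport_iff_eventuallyEq.1 hx')).eq_of_nhds]
  exact congrFun (InnerProductSpace.laplacian_const (c := (0 : ℝ))) x

lemma mul_left (h : IsTestFunction ψ) {f : Rd d → ℝ} (hf : ContDiff ℝ ∞ f) :
    IsTestFunction (fun x => f x * ψ x) where
  smooth := hf.mul h.smooth
  compact := h.compact.mul_left

lemma comp_sub_left (h : IsTestFunction ψ) (x : Rd d) : IsTestFunction (fun y => ψ (x - y)) where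
  smooth := h.smooth.comp (contDiff_const.sub contDiff_id)
  compact := h.compact.comp_homeomorph (Homeomorph.subLeft x)

lemma fderiv_comp_sub_left (h : IsTestFunction ψ) (x y e : Rd d) :
    fderiv ℝ (fun y => ψ (x - y)) y e = - fderiv ℝ ψ (x - y) e := by
  have h1 : HasFDerivAt (fun y : Rd d => x - y) (-ContinuousLinearMap.id ℝ (Rd d)) y :=
    (hasFDerivAt_id y).const_sub x
  have h2 := ((h.differentiable (x - y)).hasFDerivAt.comp y h1).fderiv
  rw [show (fun y => ψ (x - y)) = ψ ∘ fun y => x - y from rfl, h2]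
  simp

lemma gradient_comp_sub_left (h : IsTestFunction ψ) (x y : Rd d) :
    (∇ (fun y => ψ (x - y))) y = - (∇ ψ) (x - y) := by
  refine ext_inner_right ℝ fun v => ?_
  rw [inner_gradient_left, inner_neg_left, inner_gradient_left, h.fderiv_comp_sub_left]

lemma laplacian_comp_sub_left (h : IsTestFunction ψ) (x y : Rd d) :
    (Δ (fun y => ψ (x - y))) y = (Δ ψ) (x - y) := by
  rw [laplacian_eq_sum_fderiv ((h.comp_sub_left x).contDiff (n := 2)),
    laplacian_eq_sum_fderiv (h.contDiff (n := 2))]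
  refine Finset.sum_congr rfl fun i _ => ?_
  simp_rw [h.fderiv_comp_sub_left x]
  rw [fderiv_fun_neg, neg_apply, (h.fderiv_apply _).fderiv_comp_sub_left,
    neg_neg]

end IsTestFunction

/-- Differentiation of a convolution falls on the smooth factor. -/
lemma fderiv_convolution_left {k : Rd d → ℝ} (hk : IsTestFunction k) {f : Rd d → ℝ}
    (hf : LocallyIntegrable f volume) (x e : Rd d) :
    fderiv ℝ (k ⋆[lsmul ℝ ℝ, volume] f) x e =
      ((fun z => fderiv ℝ k z e) ⋆[lsmul ℝ ℝ, volume] f) x := by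
  rw [(hk.compact.hasFDerivAt_convolution_left (lsmul ℝ ℝ) (hk.contDiff (n := 1)) hf x).fderiv]
  have h1 := (hk.compact.fderiv (𝕜 := ℝ)).convolutionExists_left
    ((lsmul ℝ ℝ : ℝ →L[ℝ] ℝ →L[ℝ] ℝ).precompL (Rd d))
    ((hk.contDiff (n := 1)).continuous_fderiv one_ne_zero) hf x
  simp_rw [convolution_def, ContinuousLinearMap.integral_apply h1]
  rfl

lemma laplacian_convolution_left {k : Rd d → ℝ} (hk : IsTestFunction k) {f : Rd d → ℝ}
    (hf : LocallyIntegrable f volume) (x : Rd d) :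
    (Δ (k ⋆[lsmul ℝ ℝ, volume] f)) x = ∫ y, f y * (Δ k) (x - y) := by
  have h2 : ContDiff ℝ 2 (k ⋆[lsmul ℝ ℝ, volume] f) :=
    hk.compact.contDiff_convolution_left (n := 2) _ (hk.contDiff (n := 2)) hf
  rw [laplacian_eq_sum_fderiv h2]
  simp_rw [fderiv_convolution_left hk hf]
  simp_rw [fun e => fderiv_convolution_left (hk.fderiv_apply e) hf]
  simp_rw [laplacian_eq_sum_fderiv (hk.contDiff (n := 2)), Finset.mul_sum, convolution_lsmul_swap,
    smul_eq_mul]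
  rw [integral_finsetSum]
  · simp_rw [mul_comm]
  · intro i _
    have hk2 := (hk.fderiv_apply (EuclideanSpace.basisFun (Fin d) ℝ i)).fderiv_apply
      (EuclideanSpace.basisFun (Fin d) ℝ i)
    have := (hk2.compact.convolutionExists_left (lsmul ℝ ℝ) hk2.continuous hf x).integrable_swap
    simpa [mul_comm] using this

lemma integrable_smul_of_hasCompactSupport {F : Type*} [NormedAddCommGroup F] [NormedSpace ℝ F]
    {f : Rd d → ℝ} (hf : LocallyIntegrable f volume) {g : Rd d → F} (hg : Continuous g)
    (hgs : HasCompactSupport g) : Integrable (fun x => f x • g x) volume :=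
  hf.integrable_smul_right_of_hasCompactSupport hg hgs

lemma isTestFunction_normed (φ : ContDiffBump (0 : Rd d)) :
    IsTestFunction (φ.normed (volume : Measure (Rd d))) :=
  ⟨φ.contDiff_normed (n := (⊤ : ℕ∞)), φ.hasCompactSupport_normed⟩

lemma gradient_convolution_left {k : Rd d → ℝ} (hk : IsTestFunction k) {f : Rd d → ℝ}
    (hf : LocallyIntegrable f volume) (x : Rd d) :
    (∇ (k ⋆[lsmul ℝ ℝ, volume] f)) x = ∫ y, f y • (∇ k) (x - y) := by
  refine ext_inner_right ℝ fun v => ?_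
  have hc : Continuous (fun y => (∇ k) (x - y)) :=
    hk.continuous_gradient.comp (continuous_const.sub continuous_id)
  have hs : HasCompactSupport (fun y => (∇ k) (x - y)) :=
    hk.hasCompactSupport_gradient.comp_homeomorph (Homeomorph.subLeft x)
  rw [inner_gradient_left, fderiv_convolution_left hk hf, convolution_lsmul_swap,
    real_inner_comm, ← integral_inner (integrable_smul_of_hasCompactSupport hf hc hs)]
  congr 1; ext y
  rw [real_inner_smul_right, real_inner_comm, inner_gradient_left, smul_eq_mul, mul_comm]

/-- Mollification turns a weak gradient into a classical one. -/
lemma IsWeakGradient.gradient_mollify {f : Rd d → ℝ} {G : Rd d → Rd d} (hG : IsWeakGradient f G)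
    (hf : LocallyIntegrable f volume) (φ : ContDiffBump (0 : Rd d)) (x : Rd d) :
    (∇ (mollify φ f)) x = mollify φ G x := by
  have hη := isTestFunction_normed φ
  have h := hG _ (hη.comp_sub_left x)
  simp_rw [hη.gradient_comp_sub_left, smul_neg, integral_neg, neg_inj] at h
  rw [mollify_apply, ← h, mollify, gradient_convolution_left hη hf]

/-- Green's identity. -/
lemma integral_mul_laplacian {p h : Rd d → ℝ} (hp : IsTestFunction p) (hh : ContDiff ℝ 2 h) :
    ∫ x, p x * (Δ h) x = - ∫ x, ⟪(∇ p) x, (∇ h) x⟫ := by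
  set b := EuclideanSpace.basisFun (Fin d) ℝ
  have hd : ∀ i, ContDiff ℝ 1 (fun z => fderiv ℝ h z (b i)) := fun i =>
    (hh.fderiv_right (m := 1) (by norm_num)).clm_apply contDiff_const
  have hdd : ∀ i, Continuous (fun z => fderiv ℝ (fun z => fderiv ℝ h z (b i)) z (b i)) := fun i =>
    ((hd i).continuous_fderiv one_ne_zero).clm_apply continuous_const
  have i1 : ∀ i, Integrable (fun x => p x * fderiv ℝ (fun z => fderiv ℝ h z (b i)) x (b i)) :=
    fun i => (hp.continuous.mul (hdd i)).integrable_of_hasCompactSupport hp.compact.mul_right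
  have i2 : ∀ i, Integrable (fun x => fderiv ℝ p x (b i) * fderiv ℝ h x (b i)) := fun i =>
    ((hp.fderiv_apply (b i)).continuous.mul (hd i).continuous).integrable_of_hasCompactSupport
      (hp.fderiv_apply (b i)).compact.mul_right
  have i3 : ∀ i, Integrable (fun x => p x * fderiv ℝ h x (b i)) := fun i =>
    (hp.continuous.mul (hd i).continuous).integrable_of_hasCompactSupport hp.compact.mul_right
  have hinner : ∀ x, ⟪(∇ p) x, (∇ h) x⟫ = ∑ i, fderiv ℝ p x (b i) * fderiv ℝ h x (b i) := by
    intro x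
    rw [← b.sum_inner_mul_inner]
    refine Finset.sum_congr rfl fun i _ => ?_
    rw [inner_gradient_left, inner_gradient_right, conj_trivial]
  simp_rw [hinner, laplacian_eq_sum_fderiv hh, Finset.mul_sum]
  rw [integral_finsetSum _ fun i _ => i1 i, integral_finsetSum _ fun i _ => i2 i,
    ← Finset.sum_neg_distrib]
  refine Finset.sum_congr rfl fun i _ => ?_
  exact integral_mul_fderiv_eq_neg_fderiv_mul_of_integrable (i2 i) (i1 i) (i3 i)
    (fun x _ => hp.differentiable x) (fun x _ => (hd i).differentiable one_ne_zero x)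

end Calculus

/-! ### Transport by a square-integrable divergence-free field -/

section SquareIntegrable

variable {X : Type*} [MeasurableSpace X] {μ : Measure X} {E F : Type*} [NormedAddCommGroup E]
  [NormedAddCommGroup F]

lemma integrable_norm_mul_norm {f : X → E} {g : X → F} (hf : MemLp f 2 μ) (hg : MemLp g 2 μ) :
    Integrable (fun x => ‖f x‖ * ‖g x‖) μ :=
  hf.norm.integrable_mul hg.norm

/-- The Cauchy–Schwarz inequality in `L²`. -/
lemma integral_norm_mul_norm_le {f : X → E} {g : X → F} (hf : MemLp f 2 μ) (hg : MemLp g 2 μ) :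
    ∫ x, ‖f x‖ * ‖g x‖ ∂μ ≤ (eLpNorm f 2 μ).toReal * (eLpNorm g 2 μ).toReal := by
  have h := eLpNorm_smul_le_mul_eLpNorm (p := 2) (q := 2) (r := 1) hg.norm.1 hf.norm.1
  rw [eLpNorm_norm, eLpNorm_norm] at h
  have h2 := ENNReal.toReal_mono (ENNReal.mul_ne_top hf.2.ne hg.2.ne) h
  rw [ENNReal.toReal_mul] at h2
  refine le_trans (le_of_eq ?_) h2
  rw [eLpNorm_one_eq_lintegral_enorm, ← integral_norm_eq_lintegral_enorm
    (hf.norm.1.smul hg.norm.1)]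
  simp

lemma integrable_inner_of_memLp [InnerProductSpace ℝ E] {f g : X → E} (hf : MemLp f 2 μ)
    (hg : MemLp g 2 μ) : Integrable (fun x => ⟪f x, g x⟫) μ :=
  (integrable_norm_mul_norm hf hg).mono (hf.1.inner hg.1) <| Eventually.of_forall fun x => by
    simpa using abs_real_inner_le_norm (f x) (g x)

lemma tendsto_integral_inner [InnerProductSpace ℝ E] {f : X → E} (hf : MemLp f 2 μ)
    {g : ℕ → X → E} {g' : X → E} (hg : ∀ n, MemLp (g n) 2 μ) (hg' : MemLp g' 2 μ)
    (h : Tendsto (fun n => eLpNorm (g n - g') 2 μ) atTop (𝓝 0)) :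
    Tendsto (fun n => ∫ x, ⟪f x, g n x⟫ ∂μ) atTop (𝓝 (∫ x, ⟪f x, g' x⟫ ∂μ)) := by
  rw [tendsto_iff_norm_sub_tendsto_zero]
  have h0 : Tendsto (fun n => (eLpNorm f 2 μ).toReal * (eLpNorm (g n - g') 2 μ).toReal) atTop
      (𝓝 0) := by
    simpa using ((ENNReal.tendsto_toReal ENNReal.zero_ne_top).comp h).const_mul
      (eLpNorm f 2 μ).toReal
  refine squeeze_zero (fun _ => norm_nonneg _) (fun n => ?_) h0
  rw [← integral_sub (integrable_inner_of_memLp hf (hg n)) (integrable_inner_of_memLp hf hg')]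
  refine (norm_integral_le_integral_norm _).trans
    (le_trans (integral_mono_of_nonneg (Eventually.of_forall fun _ => norm_nonneg _)
      (integrable_norm_mul_norm hf ((hg n).sub hg')) (Eventually.of_forall fun x => ?_))
      (integral_norm_mul_norm_le hf ((hg n).sub hg')))
  simp only [Pi.sub_apply, ← inner_sub_right]
  exact norm_inner_le_norm _ _

end SquareIntegrable

section Transport

variable {d : ℕ}

/-- A sequence of bump functions concentrating at the origin. -/
def shrinkingBump (d n : ℕ) : ContDiffBump (0 : Rd d) where
  rIn := 1 / (n + 2)
  rOut := 1 / (n + 1)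
  rIn_pos := by positivity
  rIn_lt_rOut := by
    apply one_div_lt_one_div_of_lt <;> first | positivity | linarith

lemma tendsto_rOut_shrinkingBump : Tendsto (fun n => (shrinkingBump d n).rOut) atTop (𝓝 0) :=
  tendsto_one_div_add_atTop_nhds_zero_nat

lemma memLp_mul_of_hasCompactSupport {F : Type*} [NormedAddCommGroup F] [NormedSpace ℝ F]
    {f : Rd d → F} {p : ENNReal} (hf : MemLp f p volume) {g : Rd d → ℝ} (hg : Continuous g)
    (hgs : HasCompactSupport g) : MemLp (fun x => g x • f x) p volume :=
  hf.smul (r := p) (hg.memLp_top_of_hasCompactSupport hgs volume)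

lemma memLp_inner_of_hasCompactSupport {v w : Rd d → Rd d} {p : ENNReal} (hv : MemLp v p volume)
    (hw : Continuous w) (hws : HasCompactSupport w) :
    MemLp (fun x => ⟪v x, w x⟫) p volume := by
  obtain ⟨C, hC⟩ := hw.bounded_above_of_compact_support hws
  refine hv.of_le_mul (c := C) (hv.1.inner hw.aestronglyMeasurable)
    (Eventually.of_forall fun x => ?_)
  calc ‖⟪v x, w x⟫‖ ≤ ‖v x‖ * ‖w x‖ := norm_inner_le_norm _ _
    _ ≤ C * ‖v x‖ := by rw [mul_comm]; gcongr; exact hC x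

lemma integral_mul_inner_gradient_of_contDiff {v : Rd d → Rd d} (hv : MemLp v 2 volume)
    (hdiv : IsDivergenceFree v) {g ψ : Rd d → ℝ} (hg : ContDiff ℝ ∞ g) (hψ : IsTestFunction ψ) :
    ∫ x, ψ x * ⟪v x, (∇ g) x⟫ = - ∫ x, g x * ⟪v x, (∇ ψ) x⟫ := by
  have hgd : Differentiable ℝ g := hg.differentiable (by simp)
  have h := hdiv _ (hψ.mul_left hg)
  have hgrad : ∀ x, (∇ (fun x => g x * ψ x)) x = g x • (∇ ψ) x + ψ x • (∇ g) x := fun x =>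
    gradient_mul (hgd x) (hψ.differentiable x)
  simp_rw [hgrad, inner_add_right, real_inner_smul_right] at h
  have hgc : Continuous (∇ g) := continuous_gradient (hg.of_le (by exact_mod_cast le_top))
  have i1 : Integrable (fun x => g x * ⟪v x, (∇ ψ) x⟫) := by
    have hm : MemLp (fun x => g x • (∇ ψ) x) 2 volume :=
      (hg.continuous.smul hψ.continuous_gradient).memLp_of_hasCompactSupport
        hψ.hasCompactSupport_gradient.smul_left
    simpa [real_inner_smul_right] using integrable_inner_of_memLp hv hm
  have i2 : Integrable (fun x => ψ x * ⟪v x, (∇ g) x⟫) := by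
    have hm : MemLp (fun x => ψ x • (∇ g) x) 2 volume :=
      (hψ.continuous.smul hgc).memLp_of_hasCompactSupport hψ.compact.smul_right
    simpa [real_inner_smul_right] using integrable_inner_of_memLp hv hm
  rw [integral_add i1 i2] at h
  linarith

/-- The transport term may be integrated by parts against a square-integrable divergence-free field
when the transported function has a square-integrable weak gradient. -/
lemma IsWeakGradient.integral_mul_inner_gradient {f : Rd d → ℝ} {G v : Rd d → Rd d}
    (hG : IsWeakGradient f G) (hf : MemLp f 2 volume) (hGL : MemLp G 2 volume)
    (hv : MemLp v 2 volume) (hdiv : IsDivergenceFree v) {ψ : Rd d → ℝ} (hψ : IsTestFunction ψ) :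
    ∫ x, f x * ⟪v x, (∇ ψ) x⟫ = - ∫ x, ψ x * ⟪v x, G x⟫ := by
  set φ := shrinkingBump d
  have hfl := hf.locallyIntegrable one_le_two
  have hGl := hGL.locallyIntegrable one_le_two
  have hkey : ∀ n, ∫ x, mollify (φ n) f x * ⟪v x, (∇ ψ) x⟫
      = - ∫ x, ψ x * ⟪v x, mollify (φ n) G x⟫ := by
    intro n
    have := integral_mul_inner_gradient_of_contDiff hv hdiv (contDiff_mollify (φ n) hfl) hψ
    simp_rw [hG.gradient_mollify hfl] at this
    linarith
  have hw1 := memLp_inner_of_hasCompactSupport hv hψ.continuous_gradient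
    hψ.hasCompactSupport_gradient
  have hw2 : MemLp (fun x => ψ x • v x) 2 volume :=
    memLp_mul_of_hasCompactSupport hv hψ.continuous hψ.compact
  have t1 := tendsto_integral_inner hw1 (fun n => memLp_mollify (φ n) one_le_two (by simp) hf) hf
    (tendsto_eLpNorm_mollify_sub tendsto_rOut_shrinkingBump one_le_two (by simp) hf)
  have t2 := tendsto_integral_inner hw2 (fun n => memLp_mollify (φ n) one_le_two (by simp) hGL) hGL
    (tendsto_eLpNorm_mollify_sub tendsto_rOut_shrinkingBump one_le_two (by simp) hGL)
  simp only [real_inner_smul_left, RCLike.inner_apply, conj_trivial] at t1 t2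
  refine tendsto_nhds_unique t1 ?_
  simp_rw [hkey]
  exact t2.neg

/-- The right-hand side of the equation, tested with a translated mollifier. -/
lemma flux_mollifier {f : Rd d → ℝ} {G v : Rd d → Rd d}
    (hG : IsWeakGradient f G) (hf : MemLp f 2 volume) (hGL : MemLp G 2 volume)
    (hv : MemLp v 2 volume) (hdiv : IsDivergenceFree v) (φ : ContDiffBump (0 : Rd d)) (κ : ℝ)
    (x : Rd d) :
    ∫ y, f y * (κ * (Δ (fun y => φ.normed volume (x - y))) y
        + ⟪v y, (∇ (fun y => φ.normed volume (x - y))) y⟫)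
      = κ * (Δ (mollify φ f)) x - mollify φ (fun y => ⟪v y, G y⟫) x := by
  have hη := isTestFunction_normed φ
  have hηx := hη.comp_sub_left x
  have hfl := hf.locallyIntegrable one_le_two
  have i1 : Integrable (fun y => f y * (κ * (Δ (fun y => φ.normed volume (x - y))) y)) := by
    have := integrable_smul_of_hasCompactSupport hfl
      (hηx.continuous_laplacian.const_smul κ) (hηx.hasCompactSupport_laplacian.smul_left (f := fun _ => κ))
    simpa using this
  have i2 : Integrable (fun y => f y * ⟪v y, (∇ (fun y => φ.normed volume (x - y))) y⟫) := by
    have hm := memLp_inner_of_hasCompactSupport hv hηx.continuous_gradient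
      hηx.hasCompactSupport_gradient
    exact hf.integrable_mul hm
  simp_rw [mul_add]
  rw [integral_add i1 i2, hG.integral_mul_inner_gradient hf hGL hv hdiv hηx, ← sub_eq_add_neg]
  congr 1
  · simp_rw [hη.laplacian_comp_sub_left x, mul_left_comm _ κ, integral_const_mul, mollify,
      laplacian_convolution_left hη hfl]
  · rw [mollify_apply]; rfl

end Transport

/-! ### The truncated square and the transport commutator -/

section ChainRule

/-- The fundamental theorem of calculus for `b ∘ H`, where `H` is the integral of a bounded
function. -/
lemma sub_eq_integral_deriv_comp_mul {b : ℝ → ℝ} {N : NNReal} (hb : ContDiff ℝ 1 b)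
    (hbN : ∀ x, |deriv b x| ≤ N) {q : ℝ → ℝ} {t C : ℝ} (ht : 0 ≤ t)
    (hqm : AEStronglyMeasurable q (volume.restrict (Ioc 0 t)))
    (hq : ∀ᵐ s ∂(volume.restrict (Ioc 0 t)), |q s| ≤ C) {H : ℝ → ℝ}
    (hH : ∀ s ∈ Icc 0 t, H s = H 0 + ∫ τ in (0 : ℝ)..s, q τ) :
    b (H t) - b (H 0) = ∫ s in (0 : ℝ)..t, deriv b (H s) * q s := by
  have hqi : IntervalIntegrable q volume 0 t := by
    rw [intervalIntegrable_iff_integrableOn_Ioc_of_le ht]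
    exact Integrable.of_bound hqm C hq
  set J : ℝ → ℝ := fun s => H 0 + ∫ τ in (0 : ℝ)..s, q τ with hJ
  have hbL : LipschitzWith N b := by
    refine lipschitzWith_of_nnnorm_deriv_le (hb.differentiable one_ne_zero) fun x => ?_
    have := hbN x
    rw [← Real.norm_eq_abs] at this
    exact_mod_cast this
  have hJL : LipschitzOnWith (Real.toNNReal C) J (uIcc 0 t) := by
    rw [uIcc_of_le ht]
    refine LipschitzOnWith.of_dist_le_mul fun x hx y hy => ?_
    have hx' : IntervalIntegrable q volume 0 x :=
      hqi.mono_set (by rw [uIcc_of_le ht, uIcc_of_le hx.1]; exact Icc_subset_Icc_right hx.2)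
    have hy' : IntervalIntegrable q volume 0 y :=
      hqi.mono_set (by rw [uIcc_of_le ht, uIcc_of_le hy.1]; exact Icc_subset_Icc_right hy.2)
    rw [dist_eq_norm, hJ]
    simp only [add_sub_add_left_eq_sub]
    rw [intervalIntegral.integral_interval_sub_left hx' hy', Real.dist_eq, Real.coe_toNNReal']
    refine (intervalIntegral.norm_integral_le_of_norm_le_const_ae (C := max C 0) ?_)
    rw [ae_restrict_iff' measurableSet_Ioc] at hq
    filter_upwards [hq] with s hs hs'
    refine (hs ?_).trans (le_max_left _ _)
    rw [uIoc, mem_Ioc] at hs'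
    exact ⟨(le_min hy.1 hx.1).trans_lt hs'.1, hs'.2.trans (max_le hy.2 hx.2)⟩
  have hac : AbsolutelyContinuousOnInterval (b ∘ J) 0 t :=
    ((hbL.lipschitzOnWith (s := univ)).comp hJL
      (fun _ _ => mem_univ _)).absolutelyContinuousOnInterval
  have h1 := hac.integral_deriv_eq_sub
  have hJt : J t = H t := (hH t ⟨ht, le_rfl⟩).symm
  have hJ0 : J 0 = H 0 := by simp [hJ]
  simp only [Function.comp, hJt, hJ0] at h1
  rw [← h1]
  have hd := hqi.ae_hasDerivAt_integral
  refine intervalIntegral.integral_congr_ae ?_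
  filter_upwards [hd] with s hs hs'
  have hs1 : s ∈ uIcc 0 t := uIoc_subset_uIcc hs'
  have h2 : HasDerivAt J (q s) s := (hs hs1 0 left_mem_uIcc).const_add (H 0)
  have h3 := ((hb.differentiable one_ne_zero (J s)).hasDerivAt.comp s h2).deriv
  rw [uIcc_of_le ht] at hs1
  rw [show H s = J s from hH s hs1]
  exact h3

end ChainRule

section Renormalization

/-- Smooth convex functions vanishing at the origin, with derivative bounded by `N` and by the
identity, as used for truncating the square. -/
structure IsRenormalization (N : NNReal) (b : ℝ → ℝ) : Prop where
  smooth : ContDiff ℝ ∞ b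
  abs_deriv_le : ∀ x, |deriv b x| ≤ N
  abs_deriv_le_abs : ∀ x, |deriv b x| ≤ |x|
  convex : ∀ x, 0 ≤ deriv (deriv b) x
  nonneg : ∀ x, 0 ≤ b x
  le_mul_abs : ∀ x, b x ≤ N * |x|
  le_sq : ∀ x, b x ≤ x ^ 2 / 2

/-- The truncated square `N √(N² + x²) - N²`, increasing to `x² / 2` as `N → ∞`. -/
def truncatedSquare (N x : ℝ) : ℝ := N * √(N ^ 2 + x ^ 2) - N ^ 2

lemma hasDerivAt_truncatedSquare {N : ℝ} (hN : 0 < N) (x : ℝ) :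
    HasDerivAt (truncatedSquare N) (N * (x / √(N ^ 2 + x ^ 2))) x := by
  have h0 : N ^ 2 + x ^ 2 ≠ 0 := by positivity
  have h1 : HasDerivAt (fun x : ℝ => N ^ 2 + x ^ 2) (2 * x) x := by
    simpa using (hasDerivAt_pow 2 x).const_add (N ^ 2)
  have h2 := ((h1.sqrt h0).const_mul N).sub_const (N ^ 2)
  have h3 : HasDerivAt (truncatedSquare N) (N * (2 * x / (2 * √(N ^ 2 + x ^ 2)))) x := h2
  rwa [mul_div_mul_left _ _ two_ne_zero] at h3

lemma deriv_truncatedSquare {N : ℝ} (hN : 0 < N) :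
    deriv (truncatedSquare N) = fun x => N * (x / √(N ^ 2 + x ^ 2)) :=
  funext fun x => (hasDerivAt_truncatedSquare hN x).deriv

lemma truncatedSquare_eq {N : ℝ} (hN : 0 < N) (x : ℝ) :
    truncatedSquare N x = x ^ 2 / (√(1 + (x / N) ^ 2) + 1) := by
  have h1 : √(N ^ 2 + x ^ 2) = N * √(1 + (x / N) ^ 2) := by
    rw [← Real.sqrt_sq hN.le, ← Real.sqrt_mul (by positivity), Real.sqrt_sq hN.le]
    congr 1; field_simp
  have h2 : √(1 + (x / N) ^ 2) ^ 2 = 1 + (x / N) ^ 2 := Real.sq_sqrt (by positivity)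
  have h3 : 0 < √(1 + (x / N) ^ 2) + 1 := by positivity
  rw [truncatedSquare, h1, eq_div_iff h3.ne']
  have h4 : x ^ 2 = N ^ 2 * (√(1 + (x / N) ^ 2) ^ 2 - 1) := by rw [h2]; field_simp; ring
  linear_combination -h4

lemma truncatedSquare_le {N : ℝ} (hN : 0 < N) (x : ℝ) : truncatedSquare N x ≤ x ^ 2 / 2 := by
  rw [truncatedSquare_eq hN]
  have : 1 ≤ √(1 + (x / N) ^ 2) := by
    rw [Real.one_le_sqrt]; nlinarith [sq_nonneg (x / N)]
  gcongr
  linarith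

lemma tendsto_truncatedSquare (x : ℝ) :
    Tendsto (fun n : ℕ => truncatedSquare ((n : ℝ) + 1) x) atTop (𝓝 (x ^ 2 / 2)) := by
  have h : ∀ n : ℕ, truncatedSquare ((n : ℝ) + 1) x
      = x ^ 2 / (√(1 + (x * (1 / ((n : ℝ) + 1))) ^ 2) + 1) := fun n => by
    rw [truncatedSquare_eq (by positivity)]; simp [div_eq_mul_inv]
  simp_rw [h]
  have h1 := ((((tendsto_one_div_add_atTop_nhds_zero_nat (𝕜 := ℝ)).const_mul x).pow 2).const_add
    1).sqrt.add_const 1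
  have h2 := (tendsto_const_nhds (x := x ^ 2)).div h1 (by positivity)
  have e : √(1 + (x * 0) ^ 2) + 1 = 2 := by norm_num
  rw [e] at h2
  exact h2

lemma isRenormalization_truncatedSquare {N : NNReal} (hN : 0 < N) :
    IsRenormalization N (truncatedSquare N) := by
  have hN' : (0 : ℝ) < N := hN
  have hle : ∀ x : ℝ, |x| ≤ √((N : ℝ) ^ 2 + x ^ 2) := fun x => by
    rw [← Real.sqrt_sq_eq_abs]; exact Real.sqrt_le_sqrt (by nlinarith [sq_nonneg (N : ℝ)])
  have hle' : ∀ x : ℝ, (N : ℝ) ≤ √((N : ℝ) ^ 2 + x ^ 2) := fun x =>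
    Real.le_sqrt_of_sq_le (by nlinarith [sq_nonneg x])
  have hpos : ∀ x : ℝ, 0 < √((N : ℝ) ^ 2 + x ^ 2) := fun x => hN'.trans_le (hle' x)
  have hsm : ContDiff ℝ ∞ (truncatedSquare N) := by
    refine (contDiff_const.mul (ContDiff.sqrt (by fun_prop) fun x => ?_)).sub contDiff_const
    positivity
  refine ⟨hsm, fun x => ?_, fun x => ?_, fun x => ?_, fun x => ?_, fun x => ?_,
    truncatedSquare_le hN'⟩
  · rw [deriv_truncatedSquare hN', abs_mul, abs_div, abs_of_pos hN', abs_of_pos (hpos x)]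
    exact mul_le_of_le_one_right hN'.le ((div_le_one (hpos x)).2 (hle x))
  · rw [deriv_truncatedSquare hN', abs_mul, abs_div, abs_of_pos hN', abs_of_pos (hpos x),
      mul_div_assoc', div_le_iff₀ (hpos x), mul_comm]
    gcongr
    exact hle' x
  · rw [deriv_truncatedSquare hN']
    have h0 : (N : ℝ) ^ 2 + x ^ 2 ≠ 0 := by positivity
    have h1 : HasDerivAt (fun x : ℝ => (N : ℝ) ^ 2 + x ^ 2) (2 * x) x := by
      simpa using (hasDerivAt_pow 2 x).const_add ((N : ℝ) ^ 2)
    have h2 := ((hasDerivAt_id x).fun_div (h1.sqrt h0) (hpos x).ne').const_mul (N : ℝ)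
    simp only [id] at h2
    have h3 := h2.deriv
    rw [h3]
    have h4 : 1 * √((N : ℝ) ^ 2 + x ^ 2) - x * (2 * x / (2 * √((N : ℝ) ^ 2 + x ^ 2)))
        = (N : ℝ) ^ 2 / √((N : ℝ) ^ 2 + x ^ 2) := by
      have := Real.sq_sqrt (show 0 ≤ (N : ℝ) ^ 2 + x ^ 2 by positivity)
      have hp := (hpos x).ne'
      field_simp
      rw [this]; ring
    rw [h4]
    positivity
  · rw [truncatedSquare_eq hN']; positivity
  · have h1 : √((N : ℝ) ^ 2 + x ^ 2) ≤ N + |x| := by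
      rw [Real.sqrt_le_left (by positivity)]
      nlinarith [sq_abs x, abs_nonneg x]
    rw [truncatedSquare]
    nlinarith

namespace IsRenormalization

variable {N : NNReal} {b : ℝ → ℝ}

lemma smooth_deriv (hb : IsRenormalization N b) : ContDiff ℝ ∞ (deriv b) :=
  ((contDiff_succ_iff_deriv (n := ∞)).1 (by simpa using hb.smooth)).2.2

lemma lipschitzWith (hb : IsRenormalization N b) : LipschitzWith N b := by
  refine lipschitzWith_of_nnnorm_deriv_le (hb.smooth.differentiable (by simp)) fun x => ?_
  have := hb.abs_deriv_le x
  rw [← Real.norm_eq_abs] at this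
  exact_mod_cast this

end IsRenormalization

end Renormalization

section Commutator

variable {d : ℕ}

lemma eLpNorm_inner_le {v G : Rd d → Rd d} (hv : AEStronglyMeasurable v volume)
    (hG : AEStronglyMeasurable G volume) :
    eLpNorm (fun x => ⟪v x, G x⟫) 1 volume ≤ eLpNorm v 2 volume * eLpNorm G 2 volume := by
  have h := eLpNorm_smul_le_mul_eLpNorm (p := 2) (q := 2) (r := 1) hG.norm hv.norm
  rw [eLpNorm_norm, eLpNorm_norm] at h
  refine le_trans (eLpNorm_mono fun x => ?_) h
  simpa using abs_real_inner_le_norm (v x) (G x)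

/-- The defect between mollifying the transport term and transporting the mollification. -/
def commutator (φ : ContDiffBump (0 : Rd d)) (v G : Rd d → Rd d) (x : Rd d) : ℝ :=
  ⟪v x, mollify φ G x⟫ - mollify φ (fun y => ⟪v y, G y⟫) x

variable {v G : Rd d → Rd d}

lemma memLp_commutator (hv : MemLp v 2 volume) (hG : MemLp G 2 volume)
    (φ : ContDiffBump (0 : Rd d)) : MemLp (commutator φ v G) 1 volume :=
  (memLp_one_iff_integrable.2 (integrable_inner_of_memLp hv
    (memLp_mollify φ one_le_two (by simp) hG))).sub
  (memLp_mollify φ le_rfl (by simp) (memLp_one_iff_integrable.2 (integrable_inner_of_memLp hv hG)))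

lemma eLpNorm_commutator_le (hv : MemLp v 2 volume) (hG : MemLp G 2 volume)
    (φ : ContDiffBump (0 : Rd d)) :
    eLpNorm (commutator φ v G) 1 volume ≤ 2 * (eLpNorm v 2 volume * eLpNorm G 2 volume) := by
  have hm := memLp_mollify φ one_le_two (by simp) hG
  have hi := memLp_one_iff_integrable.2 (integrable_inner_of_memLp hv hG)
  rw [two_mul]
  refine (eLpNorm_sub_le (hv.1.inner hm.1) (memLp_mollify φ le_rfl (by simp) hi).1 le_rfl).trans
    (add_le_add ?_ ?_)
  · refine (eLpNorm_inner_le hv.1 hm.1).trans ?_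
    gcongr
    exact eLpNorm_mollify_le φ one_le_two (by simp) hG.1
  · exact (eLpNorm_mollify_le φ le_rfl (by simp) hi.1).trans (eLpNorm_inner_le hv.1 hG.1)

lemma tendsto_eLpNorm_commutator (hv : MemLp v 2 volume) (hG : MemLp G 2 volume) :
    Tendsto (fun n => eLpNorm (commutator (shrinkingBump d n) v G) 1 volume) atTop (𝓝 0) := by
  have hi := memLp_one_iff_integrable.2 (integrable_inner_of_memLp hv hG)
  have hm := fun n => memLp_mollify (shrinkingBump d n) one_le_two (by simp) hG
  have hmi := fun n => memLp_mollify (shrinkingBump d n) le_rfl (by simp) hi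
  have t1 := tendsto_eLpNorm_mollify_sub (d := d) tendsto_rOut_shrinkingBump one_le_two (by simp) hG
  have t2 := tendsto_eLpNorm_mollify_sub (d := d) tendsto_rOut_shrinkingBump le_rfl (by simp) hi
  have t3 := (ENNReal.Tendsto.const_mul t1 (Or.inr hv.2.ne)).add t2
  rw [mul_zero, add_zero] at t3
  refine tendsto_of_tendsto_of_tendsto_of_le_of_le tendsto_const_nhds t3 (fun _ => zero_le)
    fun n => ?_
  have hdec : commutator (shrinkingBump d n) v G =
      (fun x => ⟪v x, (mollify (shrinkingBump d n) G - G) x⟫)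
      - (mollify (shrinkingBump d n) (fun y => ⟪v y, G y⟫) - fun y => ⟪v y, G y⟫) := by
    ext x; simp [commutator, inner_sub_right]
  rw [hdec]
  refine (eLpNorm_sub_le (hv.1.inner ((hm n).sub hG).1) ((hmi n).sub hi).1 le_rfl).trans ?_
  gcongr
  exact eLpNorm_inner_le hv.1 ((hm n).sub hG).1

end Commutator

/-! ### The renormalized flux at a fixed time -/

section FluxEstimate

variable {d : ℕ}

lemma l2Norm_nonneg {F : Type*} [NormedAddCommGroup F] (f : Rd d → F) : 0 ≤ l2Norm f :=
  ENNReal.toReal_nonneg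

lemma l2Norm_mollify_le {F : Type*} [NormedAddCommGroup F] [NormedSpace ℝ F]
    (φ : ContDiffBump (0 : Rd d)) {f : Rd d → F} (hf : MemLp f 2 volume) :
    l2Norm (mollify φ f) ≤ l2Norm f :=
  ENNReal.toReal_mono hf.2.ne (eLpNorm_mollify_le φ one_le_two (by simp) hf.1)

/-- At a fixed time, the flux of the mollified solution through the renormalization `b` is
controlled by the gradient of the cut-off and by the commutator: diffusion contributes a
nonpositive term because `b` is convex, and transport is a divergence. -/
lemma integral_renormalized_flux_le {f : Rd d → ℝ} {G v : Rd d → Rd d}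
    (hG : IsWeakGradient f G) (hf : MemLp f 2 volume) (hGL : MemLp G 2 volume)
    (hv : MemLp v 2 volume) (hdiv : IsDivergenceFree v) (φ : ContDiffBump (0 : Rd d))
    {κ : ℝ} (hκ : 0 ≤ κ) {N : NNReal} {b : ℝ → ℝ} (hb : IsRenormalization N b)
    {χ : Rd d → ℝ} (hχ : IsTestFunction χ) (hχ0 : ∀ x, 0 ≤ χ x) (hχ1 : ∀ x, χ x ≤ 1)
    {δ : ℝ} (hδ : ∀ x, ‖(∇ χ) x‖ ≤ δ) :
    ∫ x, χ x * (deriv b (mollify φ f x) *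
        (κ * (Δ (mollify φ f)) x - mollify φ (fun y => ⟪v y, G y⟫) x))
      ≤ δ * (κ * (l2Norm f * l2Norm G) + N * (l2Norm f * l2Norm v))
        + N * (eLpNorm (commutator φ v G) 1 volume).toReal := by
  have hfl := hf.locallyIntegrable one_le_two
  have hδ0 : 0 ≤ δ := (norm_nonneg _).trans (hδ 0)
  set h := mollify φ f with hh
  set H := mollify φ G with hH
  have hhs : ContDiff ℝ ∞ h := contDiff_mollify φ hfl
  have hh2 : ContDiff ℝ 2 h := hhs.of_le (by norm_cast)
  have hhd : Differentiable ℝ h := hhs.differentiable (by simp)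
  have hgr : ∀ x, (∇ h) x = H x := hG.gradient_mollify hfl φ
  have hhL : MemLp h 2 volume := memLp_mollify φ one_le_two (by simp) hf
  have hHL : MemLp H 2 volume := memLp_mollify φ one_le_two (by simp) hGL
  have hb1 := hb.smooth_deriv
  have hbd : Differentiable ℝ b := hb.smooth.differentiable (by simp)
  have hb1d : Differentiable ℝ (deriv b) := hb1.differentiable (by simp)
  set p : Rd d → ℝ := fun x => deriv b (h x) * χ x with hp
  have hpt : IsTestFunction p := hχ.mul_left (hb1.comp hhs)
  have hgp : ∀ x, (∇ p) x = deriv b (h x) • (∇ χ) x + χ x • (deriv (deriv b) (h x) • H x) := by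
    intro x
    rw [hp, gradient_mul (f := fun x => deriv b (h x)) ((hb1d _).comp x (hhd x))
      (hχ.differentiable x), gradient_comp_real (hb1d _) (hhd x), hgr]
  have iA : Integrable (fun x => p x * (Δ h) x) :=
    (hpt.continuous.mul (continuous_laplacian hh2)).integrable_of_hasCompactSupport
      hpt.compact.mul_right
  have iB : Integrable (fun x => p x * ⟪v x, H x⟫) :=
    memLp_one_iff_integrable.1 (memLp_mul_of_hasCompactSupport (memLp_one_iff_integrable.2
      (integrable_inner_of_memLp hv hHL)) hpt.continuous hpt.compact)
  have hcL := memLp_commutator hv hGL φ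
  have iC : Integrable (fun x => p x * commutator φ v G x) :=
    memLp_one_iff_integrable.1 (memLp_mul_of_hasCompactSupport hcL hpt.continuous hpt.compact)
  have hsplit : ∀ x, χ x * (deriv b (h x) * (κ * (Δ h) x - mollify φ (fun y => ⟪v y, G y⟫) x))
      = κ * (p x * (Δ h) x) - p x * ⟪v x, H x⟫ + p x * commutator φ v G x := by
    intro x
    simp only [commutator, hp]
    ring
  have hA : ∫ x, p x * (Δ h) x ≤ δ * (l2Norm f * l2Norm G) := by
    rw [integral_mul_laplacian hpt hh2, ← integral_neg]
    have i1 : Integrable (fun x => -⟪(∇ p) x, (∇ h) x⟫) := by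
      refine Integrable.neg ?_
      refine (hpt.continuous_gradient.inner (continuous_gradient
        (hh2.of_le one_le_two))).integrable_of_hasCompactSupport ?_
      refine hpt.hasCompactSupport_gradient.mono fun x hx h0 => hx ?_
      simp [h0]
    have hle : ∀ x, -⟪(∇ p) x, (∇ h) x⟫ ≤ δ * (‖h x‖ * ‖H x‖) := by
      intro x
      rw [hgp, hgr, inner_add_left, real_inner_smul_left, real_inner_smul_left,
        real_inner_smul_left, real_inner_self_eq_norm_sq]
      have h1 : 0 ≤ χ x * (deriv (deriv b) (h x) * ‖H x‖ ^ 2) :=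
        mul_nonneg (hχ0 x) (mul_nonneg (hb.convex _) (sq_nonneg _))
      have h2 : |deriv b (h x) * ⟪(∇ χ) x, H x⟫| ≤ |h x| * (δ * ‖H x‖) := by
        rw [abs_mul]
        refine mul_le_mul (hb.abs_deriv_le_abs _) ?_ (abs_nonneg _) (abs_nonneg _)
        exact (abs_real_inner_le_norm _ _).trans (by gcongr; exact hδ x)
      have h3 := neg_abs_le (deriv b (h x) * ⟪(∇ χ) x, H x⟫)
      rw [Real.norm_eq_abs]
      linarith
    calc ∫ x, -⟪(∇ p) x, (∇ h) x⟫ ≤ ∫ x, δ * (‖h x‖ * ‖H x‖) :=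
          integral_mono i1 ((integrable_norm_mul_norm hhL hHL).const_mul δ) hle
      _ = δ * ∫ x, ‖h x‖ * ‖H x‖ := integral_const_mul _ _
      _ ≤ δ * (l2Norm h * l2Norm H) := by
          gcongr; exact integral_norm_mul_norm_le hhL hHL
      _ ≤ _ := by
          have h1 := l2Norm_mollify_le φ hf
          have h2 := l2Norm_mollify_le φ hGL
          have h3 := l2Norm_nonneg f
          have h4 := l2Norm_nonneg H
          gcongr
  have hB : -∫ x, p x * ⟪v x, H x⟫ ≤ δ * (N * (l2Norm f * l2Norm v)) := by
    have h1 := integral_mul_inner_gradient_of_contDiff hv hdiv (hb.smooth.comp hhs) hχ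
    have h2 : ∀ x, χ x * ⟪v x, (∇ (b ∘ h)) x⟫ = p x * ⟪v x, H x⟫ := by
      intro x
      rw [show b ∘ h = fun y => b (h y) from rfl, gradient_comp_real (hbd _) (hhd x), hgr,
        real_inner_smul_right]
      simp only [hp]; ring
    simp_rw [h2] at h1
    rw [h1, neg_neg]
    have hle : ∀ x, ‖(b ∘ h) x * ⟪v x, (∇ χ) x⟫‖ ≤ δ * (N * (‖h x‖ * ‖v x‖)) := by
      intro x
      rw [norm_mul, Function.comp_apply, Real.norm_of_nonneg (hb.nonneg _)]
      calc b (h x) * ‖⟪v x, (∇ χ) x⟫‖ ≤ (N * |h x|) * (‖v x‖ * δ) := by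
            gcongr
            · exact hb.le_mul_abs _
            · exact (norm_inner_le_norm _ _).trans (by gcongr; exact hδ x)
        _ = _ := by rw [Real.norm_eq_abs]; ring
    have ig := ((integrable_norm_mul_norm hhL hv).const_mul (N : ℝ)).const_mul δ
    calc ∫ x, (b ∘ h) x * ⟪v x, (∇ χ) x⟫ ≤ ∫ x, ‖(b ∘ h) x * ⟪v x, (∇ χ) x⟫‖ :=
          (Real.le_norm_self _).trans (norm_integral_le_integral_norm _)
      _ ≤ ∫ x, δ * (N * (‖h x‖ * ‖v x‖)) :=
          integral_mono_of_nonneg (Eventually.of_forall fun _ => norm_nonneg _) ig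
            (Eventually.of_forall hle)
      _ = δ * (N * ∫ x, ‖h x‖ * ‖v x‖) := by rw [integral_const_mul, integral_const_mul]
      _ ≤ δ * (N * (l2Norm h * l2Norm v)) := by
          gcongr; exact integral_norm_mul_norm_le hhL hv
      _ ≤ _ := by
          gcongr
          · exact l2Norm_nonneg _
          · exact l2Norm_mollify_le φ hf
  have hC : ∫ x, p x * commutator φ v G x
      ≤ N * (eLpNorm (commutator φ v G) 1 volume).toReal := by
    have hle : ∀ x, ‖p x * commutator φ v G x‖ ≤ N * ‖commutator φ v G x‖ := by
      intro x
      rw [norm_mul]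
      gcongr
      simp only [hp, norm_mul, Real.norm_eq_abs]
      rw [abs_of_nonneg (hχ0 x)]
      calc |deriv b (h x)| * χ x ≤ N * 1 := by
            gcongr
            · exact hχ0 x
            · exact hb.abs_deriv_le _
            · exact hχ1 x
        _ = N := mul_one _
    rw [eLpNorm_one_eq_lintegral_enorm, ← integral_norm_eq_lintegral_enorm hcL.1,
      ← integral_const_mul]
    exact (le_abs_self _).trans ((norm_integral_le_integral_norm _).trans
      (integral_mono_of_nonneg (Eventually.of_forall fun _ => norm_nonneg _)
        ((memLp_one_iff_integrable.1 hcL).norm.const_mul _) (Eventually.of_forall hle)))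
  simp_rw [hsplit]
  have iAB : Integrable (fun x => κ * (p x * (Δ h) x) - p x * ⟪v x, H x⟫) :=
    (iA.const_mul κ).sub iB
  rw [integral_add iAB iC, integral_sub (iA.const_mul κ) iB, integral_const_mul]
  have := mul_le_mul_of_nonneg_left hA hκ
  linarith

end FluxEstimate

/-! ### The weak formulation tested with mollifiers -/

section TimeMeasurability

variable {d : ℕ} {μ : Measure ℝ} [SFinite μ] {F : Type*} [NormedAddCommGroup F]

/-- A function of `(s, y)` is measurable as a function of `((s, x), y)`. -/
lemma aestronglyMeasurable_comp_fst_snd {f : ℝ → Rd d → F}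
    (hf : AEStronglyMeasurable (fun p : ℝ × Rd d => f p.1 p.2) (μ.prod volume)) :
    AEStronglyMeasurable (fun z : (ℝ × Rd d) × Rd d => f z.1.1 z.2)
      ((μ.prod volume).prod volume) := by
  have h1 : MeasurePreserving (MeasurableEquiv.prodAssoc : (ℝ × Rd d) × Rd d ≃ᵐ _)
      ((μ.prod volume).prod volume) (μ.prod (volume.prod volume)) :=
    measurePreserving_prodAssoc μ volume volume
  have h2 : MeasurePreserving (Prod.map id Prod.swap : ℝ × Rd d × Rd d → _)
      (μ.prod (volume.prod volume)) (μ.prod (volume.prod volume)) :=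
    (MeasurePreserving.id μ).prod Measure.measurePreserving_swap
  have h3 : MeasurePreserving (MeasurableEquiv.prodAssoc.symm : ℝ × Rd d × Rd d ≃ᵐ _)
      (μ.prod (volume.prod volume)) ((μ.prod volume).prod volume) :=
    (measurePreserving_prodAssoc μ volume volume).symm
  have h4 := (h3.comp (h2.comp h1)).quasiMeasurePreserving
  exact (hf.comp_fst (ν := (volume : Measure (Rd d)))).comp_quasiMeasurePreserving h4

lemma aestronglyMeasurable_mollify [NormedSpace ℝ F] {f : ℝ → Rd d → F}
    (hf : AEStronglyMeasurable (fun p : ℝ × Rd d => f p.1 p.2) (μ.prod volume))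
    (φ : ContDiffBump (0 : Rd d)) :
    AEStronglyMeasurable (fun p : ℝ × Rd d => mollify φ (f p.1) p.2) (μ.prod volume) := by
  simp_rw [mollify_apply]
  have hc : Continuous (fun z : (ℝ × Rd d) × Rd d => φ.normed volume (z.1.2 - z.2)) :=
    φ.continuous_normed.comp (by fun_prop)
  exact (hc.aestronglyMeasurable.smul (aestronglyMeasurable_comp_fst_snd hf)).integral_prod_right'

end TimeMeasurability

section Flux

variable {d : ℕ} {u : ℝ → Rd d → Rd d} {θ : ℝ → Rd d → ℝ} {κ : ℝ}

/-- The right-hand side of the equation at a fixed time, tested with `ψ`. -/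
def flux (κ : ℝ) (f : Rd d → ℝ) (v : Rd d → Rd d) (ψ : Rd d → ℝ) : ℝ :=
  ∫ x, f x * (κ * (Δ ψ) x + ⟪v x, (∇ ψ) x⟫)

lemma aestronglyMeasurable_flux {μ : Measure ℝ} [SFinite μ]
    (hθ : AEStronglyMeasurable (fun p : ℝ × Rd d => θ p.1 p.2) (μ.prod volume))
    (hu : AEStronglyMeasurable (fun p : ℝ × Rd d => u p.1 p.2) (μ.prod volume))
    {ψ : Rd d → ℝ} (hψ : ContDiff ℝ 2 ψ) :
    AEStronglyMeasurable (fun s => flux κ (θ s) (u s) ψ) μ := by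
  have h1 : AEStronglyMeasurable (fun p : ℝ × Rd d => (Δ ψ) p.2) (μ.prod volume) :=
    ((continuous_laplacian hψ).comp continuous_snd).aestronglyMeasurable
  have h2 : AEStronglyMeasurable (fun p : ℝ × Rd d => (∇ ψ) p.2) (μ.prod volume) :=
    ((continuous_gradient (hψ.of_le one_le_two)).comp continuous_snd).aestronglyMeasurable
  exact (hθ.mul ((h1.const_mul κ).add (hu.inner h2))).integral_prod_right'

lemma aestronglyMeasurable_flux_mollifier {μ : Measure ℝ} [SFinite μ]
    (hθ : AEStronglyMeasurable (fun p : ℝ × Rd d => θ p.1 p.2) (μ.prod volume))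
    (hu : AEStronglyMeasurable (fun p : ℝ × Rd d => u p.1 p.2) (μ.prod volume))
    (φ : ContDiffBump (0 : Rd d)) :
    AEStronglyMeasurable (fun p : ℝ × Rd d =>
      flux κ (θ p.1) (u p.1) (fun y => φ.normed volume (p.2 - y))) (μ.prod volume) := by
  have hη := isTestFunction_normed φ
  simp_rw [flux, hη.laplacian_comp_sub_left, hη.gradient_comp_sub_left]
  have h1 : AEStronglyMeasurable (fun z : (ℝ × Rd d) × Rd d => (Δ (φ.normed volume)) (z.1.2 - z.2))
      ((μ.prod volume).prod volume) :=
    (hη.continuous_laplacian.comp (by fun_prop)).aestronglyMeasurable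
  have h2 : AEStronglyMeasurable (fun z : (ℝ × Rd d) × Rd d =>
      - (∇ (φ.normed volume)) (z.1.2 - z.2)) ((μ.prod volume).prod volume) :=
    (hη.continuous_gradient.comp (by fun_prop)).neg.aestronglyMeasurable
  exact ((aestronglyMeasurable_comp_fst_snd hθ).mul ((h1.const_mul κ).add
    ((aestronglyMeasurable_comp_fst_snd hu).inner h2))).integral_prod_right'

lemma abs_flux_le {f : Rd d → ℝ} {v : Rd d → Rd d} (hκ : 0 ≤ κ) (hf : MemLp f 2 volume)
    (hv : MemLp v 2 volume) {ψ : Rd d → ℝ} (hψ : MemLp (Δ ψ) 2 volume) {c : ℝ}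
    (hc : ∀ x, ‖(∇ ψ) x‖ ≤ c) :
    |flux κ f v ψ| ≤ κ * (l2Norm f * l2Norm (Δ ψ)) + c * (l2Norm f * l2Norm v) := by
  have i1 := (integrable_norm_mul_norm hf hψ).const_mul κ
  have i2 := (integrable_norm_mul_norm hf hv).const_mul c
  have hc0 : 0 ≤ c := (norm_nonneg _).trans (hc 0)
  rw [← Real.norm_eq_abs]
  calc ‖flux κ f v ψ‖ ≤ ∫ x, ‖f x * (κ * (Δ ψ) x + ⟪v x, (∇ ψ) x⟫)‖ :=
        norm_integral_le_integral_norm _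
    _ ≤ ∫ x, (κ * (‖f x‖ * ‖(Δ ψ) x‖) + c * (‖f x‖ * ‖v x‖)) := by
        refine integral_mono_of_nonneg (Eventually.of_forall fun _ => norm_nonneg _) (i1.add i2)
          (Eventually.of_forall fun x => ?_)
        simp only [norm_mul]
        have h1 : ‖κ * (Δ ψ) x + ⟪v x, (∇ ψ) x⟫‖ ≤ κ * ‖(Δ ψ) x‖ + ‖v x‖ * c := by
          refine (norm_add_le _ _).trans ?_
          rw [norm_mul, Real.norm_of_nonneg hκ]
          gcongr
          exact (norm_inner_le_norm _ _).trans (by gcongr; exact hc x)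
        calc ‖f x‖ * ‖κ * (Δ ψ) x + ⟪v x, (∇ ψ) x⟫‖ ≤ ‖f x‖ * (κ * ‖(Δ ψ) x‖ + ‖v x‖ * c) := by
              gcongr
          _ = _ := by ring
    _ = κ * (∫ x, ‖f x‖ * ‖(Δ ψ) x‖) + c * ∫ x, ‖f x‖ * ‖v x‖ := by
        rw [integral_add i1 i2, integral_const_mul, integral_const_mul]
    _ ≤ _ := by
        gcongr
        · exact integral_norm_mul_norm_le hf hψ
        · exact integral_norm_mul_norm_le hf hv

lemma exists_bound_flux_mollifier (hκ : 0 ≤ κ) (φ : ContDiffBump (0 : Rd d)) (M U : ℝ) :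
    ∃ C, ∀ (f : Rd d → ℝ) (v : Rd d → Rd d), MemLp f 2 volume → MemLp v 2 volume →
      l2Norm f ≤ M → l2Norm v ≤ U → ∀ x,
      |flux κ f v (fun y => φ.normed volume (x - y))| ≤ C := by
  have hη := isTestFunction_normed φ
  obtain ⟨c, hc⟩ := hη.continuous_gradient.bounded_above_of_compact_support
    hη.hasCompactSupport_gradient
  have hΔ : MemLp (Δ (φ.normed volume)) 2 volume :=
    hη.continuous_laplacian.memLp_of_hasCompactSupport hη.hasCompactSupport_laplacian
  refine ⟨κ * (M * l2Norm (Δ (φ.normed (volume : Measure (Rd d))))) + c * (M * U),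
    fun f v hf hv hfM hvU x => ?_⟩
  have hmp := Measure.measurePreserving_sub_left (volume : Measure (Rd d)) x
  have hΔx : (Δ (fun y => φ.normed volume (x - y))) = (Δ (φ.normed volume)) ∘ fun y => x - y :=
    funext fun y => hη.laplacian_comp_sub_left x y
  have hl2 : l2Norm (Δ (fun y => φ.normed volume (x - y))) = l2Norm (Δ (φ.normed volume)) := by
    rw [hΔx, l2Norm, eLpNorm_comp_measurePreserving hΔ.1 hmp]; rfl
  have h1 := abs_flux_le (κ := κ) (c := c) hκ hf hv
    (ψ := fun y => φ.normed volume (x - y)) (by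
      rw [hΔx]; exact hΔ.comp_measurePreserving hmp) (fun y => by
      rw [hη.gradient_comp_sub_left, norm_neg]; exact hc _)
  rw [hl2] at h1
  have hc0 : 0 ≤ c := (norm_nonneg _).trans (hc 0)
  have hM : 0 ≤ M := (l2Norm_nonneg f).trans hfM
  have h2 := l2Norm_nonneg (Δ (φ.normed (volume : Measure (Rd d))))
  have h3 := l2Norm_nonneg v
  have h4 := l2Norm_nonneg f
  exact h1.trans (by gcongr)

end Flux

/-! ### The renormalized energy balance of the mollified solution -/

section EnergyStep

variable {d : ℕ}

lemma l2Norm_sq {F : Type*} [NormedAddCommGroup F] {f : Rd d → F} (hf : MemLp f 2 volume) :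
    l2Norm f ^ 2 = ∫ x, ‖f x‖ ^ 2 := by
  have h0 : 0 ≤ ∫ x, ‖f x‖ ^ 2 := integral_nonneg fun _ => by positivity
  rw [l2Norm, hf.eLpNorm_eq_integral_rpow_norm (by simp) (by simp), ENNReal.toReal_ofReal (by positivity)]
  simp only [ENNReal.toReal_ofNat, Real.rpow_two]
  rw [← Real.rpow_two, ← Real.rpow_mul h0]
  norm_num

/-- An integrable majorant of `‖G(s)‖₂`. -/
def gradientBound (G : ℝ → Rd d → Rd d) (s : ℝ) : ℝ := 1 + ∫ x, ‖G s x‖ ^ 2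

variable {G : ℝ → Rd d → Rd d} {T : ℝ}

lemma gradientBound_nonneg (s : ℝ) : 0 ≤ gradientBound G s := by
  have : 0 ≤ ∫ x, ‖G s x‖ ^ 2 := integral_nonneg fun _ => by positivity
  rw [gradientBound]; positivity

lemma integrable_gradientBound
    (hG : MemLp (fun p : ℝ × Rd d => G p.1 p.2) 2 ((volume.restrict (Ioc 0 T)).prod volume)) :
    Integrable (gradientBound G) (volume.restrict (Ioc 0 T)) := by
  have h1 : Integrable (fun p : ℝ × Rd d => ‖G p.1 p.2‖ ^ 2)
    ((volume.restrict (Ioc 0 T)).prod volume) := hG.integrable_norm_pow (by norm_num)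
  exact (integrable_const 1).add h1.integral_prod_left

lemma ae_memLp_gradient
    (hG : MemLp (fun p : ℝ × Rd d => G p.1 p.2) 2 ((volume.restrict (Ioc 0 T)).prod volume)) :
    ∀ᵐ s ∂(volume.restrict (Ioc 0 T)), MemLp (G s) 2 volume := by
  have h1 : Integrable (fun p : ℝ × Rd d => ‖G p.1 p.2‖ ^ 2)
    ((volume.restrict (Ioc 0 T)).prod volume) := hG.integrable_norm_pow (by norm_num)
  filter_upwards [h1.prod_right_ae, hG.1.prodMk_left] with s hs hs'
  exact (memLp_two_iff_integrable_sq_norm hs').2 hs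

lemma l2Norm_le_gradientBound {s : ℝ} (h : MemLp (G s) 2 volume) :
    l2Norm (G s) ≤ gradientBound G s := by
  rw [gradientBound, ← l2Norm_sq h]
  nlinarith [sq_nonneg (l2Norm (G s) - 1), sq_nonneg (l2Norm (G s))]

variable {u : ℝ → Rd d → Rd d} {θ : ℝ → Rd d → ℝ} {θ₀ : Rd d → ℝ} {κ U M : ℝ}

lemma Ioc_prod_le_Ioi_prod :
    (volume.restrict (Ioc 0 T)).prod (volume : Measure (Rd d))
      ≤ (volume.restrict (Ioi (0 : ℝ))).prod volume :=
  Measure.prod_mono (Measure.restrict_mono Ioc_subset_Ioi_self le_rfl) le_rfl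

lemma ae_Ioc_of_ae_Ioi {P : ℝ → Prop} (h : ∀ᵐ s ∂(volume.restrict (Ioi (0 : ℝ))), P s) :
    ∀ᵐ s ∂(volume.restrict (Ioc 0 T)), P s :=
  ae_mono (Measure.restrict_mono Ioc_subset_Ioi_self le_rfl) h

lemma aestronglyMeasurable_commutator
    (hu : AEStronglyMeasurable (fun p : ℝ × Rd d => u p.1 p.2)
      ((volume.restrict (Ioc 0 T)).prod volume))
    (hG : AEStronglyMeasurable (fun p : ℝ × Rd d => G p.1 p.2)
      ((volume.restrict (Ioc 0 T)).prod volume)) (φ : ContDiffBump (0 : Rd d)) :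
    AEStronglyMeasurable (fun p : ℝ × Rd d => commutator φ (u p.1) (G p.1) p.2)
      ((volume.restrict (Ioc 0 T)).prod volume) :=
  (hu.inner (aestronglyMeasurable_mollify hG φ)).sub
    (aestronglyMeasurable_mollify (f := fun s x => ⟪u s x, G s x⟫) (hu.inner hG) φ)

lemma aestronglyMeasurable_norm_commutator
    (hu : AEStronglyMeasurable (fun p : ℝ × Rd d => u p.1 p.2)
      ((volume.restrict (Ioc 0 T)).prod volume))
    (hG : AEStronglyMeasurable (fun p : ℝ × Rd d => G p.1 p.2)
      ((volume.restrict (Ioc 0 T)).prod volume)) (φ : ContDiffBump (0 : Rd d)) :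
    AEStronglyMeasurable (fun s => (eLpNorm (commutator φ (u s) (G s)) 1 volume).toReal)
      (volume.restrict (Ioc 0 T)) := by
  simp_rw [eLpNorm_one_eq_lintegral_enorm]
  exact (aestronglyMeasurable_commutator hu hG φ).enorm.lintegral_prod_right'.ennreal_toReal.aestronglyMeasurable

lemma norm_commutator_le {s : ℝ} (hu : MemLp (u s) 2 volume) (hG : MemLp (G s) 2 volume)
    (hU : l2Norm (u s) ≤ U) (φ : ContDiffBump (0 : Rd d)) :
    ‖(eLpNorm (commutator φ (u s) (G s)) 1 volume).toReal‖ ≤ 2 * (U * gradientBound G s) := by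
  rw [Real.norm_of_nonneg ENNReal.toReal_nonneg]
  have h := ENNReal.toReal_mono (ENNReal.mul_ne_top (by simp)
    (ENNReal.mul_ne_top hu.2.ne hG.2.ne)) (eLpNorm_commutator_le hu hG φ)
  rw [ENNReal.toReal_mul, ENNReal.toReal_mul] at h
  refine h.trans ?_
  have h1 := l2Norm_le_gradientBound hG
  have h2 := l2Norm_nonneg (G s)
  have h3 := (l2Norm_nonneg (u s)).trans hU
  simp only [ENNReal.toReal_ofNat]
  change 2 * (l2Norm (u s) * l2Norm (G s)) ≤ _
  gcongr

/-- The mollified equation, pointwise in space. -/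
lemma IsWeakSolution.mollify_eq (hθ : IsWeakSolution κ u θ₀ θ) (φ : ContDiffBump (0 : Rd d))
    {t : ℝ} (ht : 0 ≤ t) (x : Rd d) :
    mollify φ (θ t) x = mollify φ θ₀ x
      + ∫ s in (0 : ℝ)..t, flux κ (θ s) (u s) (fun y => φ.normed volume (x - y)) := by
  have h := hθ.equation t ht _ ((isTestFunction_normed φ).comp_sub_left x)
  simp_rw [mollify_apply, smul_eq_mul, mul_comm (φ.normed volume _)]
  exact h

/-- The renormalized energy balance for the mollified solution. -/
lemma IsWeakSolution.integral_renormalized_mollify_le (hT : 0 ≤ T) (hκ : 0 ≤ κ)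
    (hu : IsVelocityField u)
    (hU : ∀ᵐ s ∂(volume.restrict (Ioc 0 T)), l2Norm (u s) ≤ U)
    (hθ : IsWeakSolution κ u θ₀ θ) (hθ₀ : MemLp θ₀ 2 volume)
    (hM : ∀ s ∈ Icc 0 T, l2Norm (θ s) ≤ M)
    (hG : MemLp (fun p : ℝ × Rd d => G p.1 p.2) 2 ((volume.restrict (Ioc 0 T)).prod volume))
    (hGw : ∀ᵐ s ∂(volume.restrict (Ioi (0 : ℝ))), IsWeakGradient (θ s) (G s))
    (φ : ContDiffBump (0 : Rd d)) {N : NNReal} {b : ℝ → ℝ} (hb : IsRenormalization N b)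
    {χ : Rd d → ℝ} (hχ : IsTestFunction χ) (hχ0 : ∀ x, 0 ≤ χ x) (hχ1 : ∀ x, χ x ≤ 1)
    {δ : ℝ} (hδ : ∀ x, ‖(∇ χ) x‖ ≤ δ) :
    ∫ x, χ x * b (mollify φ (θ T) x) ≤ (∫ x, χ x * b (mollify φ θ₀ x))
      + (δ * (∫ s in Ioc 0 T, (κ * (M * gradientBound G s) + N * (M * U)))
      + N * ∫ s in Ioc 0 T, (eLpNorm (commutator φ (u s) (G s)) 1 volume).toReal) := by
  set μ := volume.restrict (Ioc 0 T) with hμ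
  have hδ0 : 0 ≤ δ := (norm_nonneg _).trans (hδ 0)
  have hum := hu.measurable.mono_measure (Ioc_prod_le_Ioi_prod (T := T))
  have hθm := hθ.measurable.mono_measure (Ioc_prod_le_Ioi_prod (T := T))
  have hbd : Differentiable ℝ b := hb.smooth.differentiable (by simp)
  have hM0 : 0 ≤ M := (l2Norm_nonneg _).trans (hM 0 ⟨le_rfl, hT⟩)
  set Fl : ℝ → Rd d → ℝ := fun s x => flux κ (θ s) (u s) (fun y => φ.normed volume (x - y))
    with hFl
  obtain ⟨C, hC⟩ := exists_bound_flux_mollifier hκ φ M U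
  have hmem : ∀ᵐ s ∂μ, s ∈ Ioc 0 T := ae_restrict_mem measurableSet_Ioc
  have hFC : ∀ᵐ s ∂μ, ∀ x, |Fl s x| ≤ C := by
    filter_upwards [hmem, ae_Ioc_of_ae_Ioi hu.memLp, hU] with s hs h1 h2 x
    exact hC _ _ (hθ.memLp s hs.1.le) h1 (hM s (Ioc_subset_Icc_self hs)) h2 x
  have hmoll : ∀ x, ∀ s ∈ Icc 0 T, mollify φ (θ s) x
      = mollify φ (θ 0) x + ∫ τ in (0 : ℝ)..s, Fl τ x := by
    intro x s hs
    rw [hθ.mollify_eq φ hs.1 x, hθ.mollify_eq φ le_rfl x]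
    simp [hFl]
  have hzero : mollify φ (θ 0) = mollify φ θ₀ := by
    ext x; rw [hθ.mollify_eq φ le_rfl x]; simp
  have hchain : ∀ x, b (mollify φ (θ T) x) - b (mollify φ θ₀ x)
      = ∫ s in Ioc 0 T, deriv b (mollify φ (θ s) x) * Fl s x := by
    intro x
    rw [← hzero, ← intervalIntegral.integral_of_le hT]
    refine sub_eq_integral_deriv_comp_mul (q := fun s => Fl s x) (C := C)
      (H := fun s => mollify φ (θ s) x) (hb.smooth.of_le (by exact_mod_cast le_top))
      hb.abs_deriv_le hT ?_ ?_ (hmoll x)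
    · exact aestronglyMeasurable_flux hθm hum
        (((isTestFunction_normed φ).comp_sub_left x).contDiff (n := 2))
    · filter_upwards [hFC] with s hs using hs x
  set P : ℝ → Rd d → ℝ := fun s x => χ x * (deriv b (mollify φ (θ s) x) * Fl s x) with hP
  have hχi : Integrable χ volume := hχ.continuous.integrable_of_hasCompactSupport hχ.compact
  have hPm : AEStronglyMeasurable (fun p : ℝ × Rd d => P p.1 p.2) (μ.prod volume) := by
    have h1 : AEStronglyMeasurable (fun p : ℝ × Rd d => χ p.2) (μ.prod volume) :=
      (hχ.continuous.comp continuous_snd).aestronglyMeasurable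
    exact h1.mul ((hb.smooth_deriv.continuous.comp_aestronglyMeasurable
      (aestronglyMeasurable_mollify hθm φ)).mul (aestronglyMeasurable_flux_mollifier hθm hum φ))
  have hPi : Integrable (Function.uncurry P) (μ.prod volume) := by
    have hdom : Integrable (fun p : ℝ × Rd d => (N * C) * χ p.2) (μ.prod volume) :=
      (hχi.comp_snd μ).const_mul _
    refine hdom.mono hPm ?_
    have hae : ∀ᵐ p : ℝ × Rd d ∂(μ.prod volume), ∀ x, |Fl p.1 x| ≤ C :=
      Measure.quasiMeasurePreserving_fst.ae hFC
    filter_upwards [hae] with p hp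
    have hC0 : 0 ≤ C := (abs_nonneg _).trans (hp 0)
    simp only [Function.uncurry, hP, norm_mul, Real.norm_eq_abs]
    rw [abs_of_nonneg (hχ0 _), abs_of_nonneg hC0, NNReal.abs_eq]
    calc χ p.2 * (|deriv b (mollify φ (θ p.1) p.2)| * |Fl p.1 p.2|) ≤ χ p.2 * (N * C) := by
          have := hχ0 p.2
          gcongr
          · exact hb.abs_deriv_le _
          · exact hp _
      _ = _ := mul_comm _ _
  have hcont : ∀ f : Rd d → ℝ, MemLp f 2 volume →
      Integrable (fun x => χ x * b (mollify φ f x)) := fun f hf =>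
    (hχ.continuous.mul (hb.smooth.continuous.comp (continuous_mollify φ
      (hf.locallyIntegrable one_le_two)))).integrable_of_hasCompactSupport hχ.compact.mul_right
  have hswap : (∫ x, χ x * b (mollify φ (θ T) x)) - ∫ x, χ x * b (mollify φ θ₀ x)
      = ∫ s, ∫ x, P s x ∂volume ∂μ := by
    rw [← integral_sub (hcont _ (hθ.memLp T hT)) (hcont _ hθ₀), integral_integral_swap hPi]
    congr 1; ext x
    rw [← mul_sub, hchain x, ← integral_const_mul]
  have hcm := aestronglyMeasurable_norm_commutator hum hG.1 φ
  have hgi := integrable_gradientBound hG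
  have hci : Integrable (fun s => (eLpNorm (commutator φ (u s) (G s)) 1 volume).toReal) μ := by
    refine ((hgi.const_mul U).const_mul 2).mono' hcm ?_
    filter_upwards [ae_Ioc_of_ae_Ioi hu.memLp, hU, ae_memLp_gradient hG] with s h1 h2 h3
    exact norm_commutator_le h1 h3 h2 φ
  have hki : Integrable (fun s => κ * (M * gradientBound G s) + N * (M * U)) μ :=
    ((hgi.const_mul M).const_mul κ).add (integrable_const _)
  have hle : ∫ s, ∫ x, P s x ∂volume ∂μ ≤ ∫ s, (δ * (κ * (M * gradientBound G s) + N * (M * U))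
      + N * (eLpNorm (commutator φ (u s) (G s)) 1 volume).toReal) ∂μ := by
    refine integral_mono_ae hPi.integral_prod_left ((hki.const_mul δ).add (hci.const_mul _)) ?_
    filter_upwards [hmem, ae_Ioc_of_ae_Ioi hu.memLp, hU, ae_memLp_gradient hG,
      ae_Ioc_of_ae_Ioi hGw, ae_Ioc_of_ae_Ioi hu.divergence_free] with s hs h1 h2 h3 h4 h5
    have hf := hθ.memLp s hs.1.le
    have hkey := integral_renormalized_flux_le h4 hf h3 h1 h5 φ hκ hb hχ hχ0 hχ1 hδ
    have hflux : ∀ x, Fl s x = κ * (Δ (mollify φ (θ s))) x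
        - mollify φ (fun y => ⟪u s y, G s y⟫) x := fun x => flux_mollifier h4 hf h3 h1 h5 φ κ x
    simp only [hP, hflux]
    refine hkey.trans ?_
    have hfM := hM s (Ioc_subset_Icc_self hs)
    have hGg := l2Norm_le_gradientBound h3
    have p1 := l2Norm_nonneg (θ s)
    have p2 := l2Norm_nonneg (G s)
    have p3 := l2Norm_nonneg (u s)
    have p4 := gradientBound_nonneg (G := G) s
    gcongr
  rw [integral_add (hki.const_mul δ) (hci.const_mul _), integral_const_mul,
    integral_const_mul] at hle
  linarith

end EnergyStep

/-! ### The energy inequality -/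

section Cutoff

variable {d : ℕ}

/-- A fixed bump function equal to `1` on the unit ball. -/
def unitBump (d : ℕ) : ContDiffBump (0 : Rd d) := ⟨1, 2, one_pos, one_lt_two⟩

/-- Cut-off functions equal to `1` on the ball of radius `n + 1` and supported in the ball of radius
`2 (n + 1)`. -/
def cutoff (d n : ℕ) (x : Rd d) : ℝ :=
  unitBump d (((n : ℝ) + 1)⁻¹ • x)

lemma isTestFunction_bump (φ : ContDiffBump (0 : Rd d)) : IsTestFunction (φ : Rd d → ℝ) :=
  ⟨φ.contDiff, φ.hasCompactSupport⟩

lemma isTestFunction_cutoff (n : ℕ) : IsTestFunction (cutoff d n) where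
  smooth := (isTestFunction_bump _).smooth.comp (contDiff_const_smul _)
  compact := (isTestFunction_bump _).compact.comp_smul (by positivity)

lemma cutoff_nonneg (n : ℕ) (x : Rd d) : 0 ≤ cutoff d n x := ContDiffBump.nonneg _

lemma cutoff_le_one (n : ℕ) (x : Rd d) : cutoff d n x ≤ 1 := ContDiffBump.le_one _

lemma cutoff_eventuallyEq_one (x : Rd d) : ∀ᶠ n : ℕ in atTop, cutoff d n =ᶠ[𝓝 x] 1 := by
  obtain ⟨m, hm⟩ := exists_nat_gt ‖x‖
  filter_upwards [eventually_ge_atTop m] with n hn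
  have h1 : ∀ᶠ y in 𝓝 x, ‖y‖ < n + 1 := by
    refine (continuous_norm.tendsto x).eventually (Iio_mem_nhds ?_)
    have : (m : ℝ) ≤ n := by exact_mod_cast hn
    linarith
  filter_upwards [h1] with y hy
  refine ContDiffBump.one_of_mem_closedBall _ ?_
  change _ ∈ Metric.closedBall (0 : Rd d) 1
  rw [mem_closedBall_zero_iff, norm_smul, norm_inv, Real.norm_of_nonneg (by positivity)]
  exact (inv_mul_le_one₀ (by positivity)).2 hy.le

lemma tendsto_cutoff (x : Rd d) : Tendsto (fun n => cutoff d n x) atTop (𝓝 1) :=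
  tendsto_const_nhds.congr' <| (cutoff_eventuallyEq_one x).mono fun _ hn => hn.eq_of_nhds.symm

lemma fderiv_cutoff (n : ℕ) (x : Rd d) : fderiv ℝ (cutoff d n) x = ((n : ℝ) + 1)⁻¹ •
    fderiv ℝ (unitBump d : Rd d → ℝ) (((n : ℝ) + 1)⁻¹ • x) :=
  fderiv_comp_smul (𝕜 := ℝ) (f := (unitBump d : Rd d → ℝ)) ((n : ℝ) + 1)⁻¹

lemma exists_norm_gradient_cutoff_le (d : ℕ) :
    ∃ c : ℝ, 0 ≤ c ∧ ∀ n (x : Rd d), ‖(∇ (cutoff d n)) x‖ ≤ c * (1 / ((n : ℝ) + 1)) := by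
  have hφ := isTestFunction_bump (unitBump d)
  obtain ⟨c, hc⟩ := hφ.continuous_gradient.bounded_above_of_compact_support
    hφ.hasCompactSupport_gradient
  refine ⟨c, (norm_nonneg _).trans (hc 0), fun n x => ?_⟩
  rw [norm_gradient, fderiv_cutoff, norm_smul, ← norm_gradient, norm_inv,
    Real.norm_of_nonneg (by positivity), mul_comm, one_div]
  gcongr
  exact hc _

lemma exists_abs_laplacian_cutoff_le (d : ℕ) :
    ∃ c : ℝ, 0 ≤ c ∧ ∀ n (x : Rd d), |(Δ (cutoff d n)) x| ≤ c := by
  have hφ := isTestFunction_bump (unitBump d)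
  obtain ⟨c, hc⟩ := hφ.continuous_laplacian.bounded_above_of_compact_support
    hφ.hasCompactSupport_laplacian
  refine ⟨c, (norm_nonneg _).trans (hc 0), fun n x => ?_⟩
  set a := ((n : ℝ) + 1)⁻¹ with ha
  have ha0 : 0 ≤ a := by positivity
  have ha1 : a ≤ 1 := inv_le_one_of_one_le₀ (by linarith [Nat.cast_nonneg (α := ℝ) n])
  have hlap : (Δ (cutoff d n)) x = a * (a *
      (Δ (unitBump d : Rd d → ℝ)) (a • x)) := by
    rw [laplacian_eq_sum_fderiv ((isTestFunction_cutoff n).contDiff (n := 2)),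
      laplacian_eq_sum_fderiv (hφ.contDiff (n := 2)), Finset.mul_sum, Finset.mul_sum]
    refine Finset.sum_congr rfl fun i _ => ?_
    set e := EuclideanSpace.basisFun (Fin d) ℝ i
    simp_rw [fderiv_cutoff, ← ha, smul_apply, smul_eq_mul]
    have hd : DifferentiableAt ℝ (fun z => fderiv ℝ (unitBump d : Rd d → ℝ) (a • z) e) x :=
      ((hφ.fderiv_apply e).differentiable _).comp x (differentiableAt_id.const_smul a)
    rw [fderiv_const_mul hd, smul_apply, smul_eq_mul]
    congr 1
    have := fderiv_comp_smul (𝕜 := ℝ) (f := fun z => fderiv ℝ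
      (unitBump d : Rd d → ℝ) z e) (x := x) a
    rw [this, smul_apply, smul_eq_mul]
  rw [hlap, abs_mul, abs_mul, abs_of_nonneg ha0]
  have h1 := hc (a • x)
  rw [Real.norm_eq_abs] at h1
  calc a * (a * _) ≤ 1 * (1 * c) := by gcongr
    _ = c := by ring

end Cutoff

section EnergyInequality

variable {d : ℕ} {G : ℝ → Rd d → Rd d} {T : ℝ} {u : ℝ → Rd d → Rd d} {θ : ℝ → Rd d → ℝ}
  {θ₀ : Rd d → ℝ} {κ U M : ℝ}

lemma tendsto_integral_renormalized_mollify {N : NNReal} {b : ℝ → ℝ} (hb : IsRenormalization N b)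
    {χ : Rd d → ℝ} (hχ : IsTestFunction χ) {f : Rd d → ℝ} (hf : MemLp f 2 volume) :
    Tendsto (fun n => ∫ x, χ x * b (mollify (shrinkingBump d n) f x)) atTop
      (𝓝 (∫ x, χ x * b (f x))) := by
  have hχL : MemLp χ 2 volume := hχ.continuous.memLp_of_hasCompactSupport hχ.compact
  have hbm : ∀ {g : Rd d → ℝ}, MemLp g 2 volume → MemLp (fun x => b (g x)) 2 volume := by
    intro g hg
    refine hg.of_le_mul (c := N) (hb.smooth.continuous.comp_aestronglyMeasurable hg.1)
      (Eventually.of_forall fun x => ?_)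
    rw [Real.norm_of_nonneg (hb.nonneg _)]
    exact hb.le_mul_abs _
  have hm := fun n => memLp_mollify (shrinkingBump d n) one_le_two (by simp) hf
  have t := tendsto_eLpNorm_mollify_sub (d := d) tendsto_rOut_shrinkingBump one_le_two (by simp) hf
  have t2 := ENNReal.Tendsto.const_mul (a := (N : ENNReal)) t (Or.inr ENNReal.coe_ne_top)
  rw [mul_zero] at t2
  have t3 : Tendsto (fun n => eLpNorm ((fun x => b (mollify (shrinkingBump d n) f x))
      - fun x => b (f x)) 2 volume) atTop (𝓝 0) := by
    refine tendsto_of_tendsto_of_tendsto_of_le_of_le tendsto_const_nhds t2 (fun _ => zero_le)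
      fun n => ?_
    refine (eLpNorm_le_nnreal_smul_eLpNorm_of_ae_le_mul (c := N)
      (g := mollify (shrinkingBump d n) f - f) (Eventually.of_forall fun x => ?_) 2).trans
      (le_of_eq rfl)
    have := hb.lipschitzWith.dist_le_mul (mollify (shrinkingBump d n) f x) (f x)
    rw [dist_eq_norm, dist_eq_norm] at this
    exact_mod_cast this
  have h1 := tendsto_integral_inner hχL (fun n => hbm (hm n)) (hbm hf) t3
  simpa [mul_comm] using h1

/-- The renormalized energy inequality for a weak solution, with a spatial cut-off. -/
lemma IsWeakSolution.integral_cutoff_renormalized_le (hT : 0 ≤ T) (hκ : 0 ≤ κ)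
    (hu : IsVelocityField u)
    (hU : ∀ᵐ s ∂(volume.restrict (Ioc 0 T)), l2Norm (u s) ≤ U)
    (hθ : IsWeakSolution κ u θ₀ θ) (hθ₀ : MemLp θ₀ 2 volume)
    (hM : ∀ s ∈ Icc 0 T, l2Norm (θ s) ≤ M)
    (hG : MemLp (fun p : ℝ × Rd d => G p.1 p.2) 2 ((volume.restrict (Ioc 0 T)).prod volume))
    (hGw : ∀ᵐ s ∂(volume.restrict (Ioi (0 : ℝ))), IsWeakGradient (θ s) (G s))
    {N : NNReal} {b : ℝ → ℝ} (hb : IsRenormalization N b)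
    {χ : Rd d → ℝ} (hχ : IsTestFunction χ) (hχ0 : ∀ x, 0 ≤ χ x) (hχ1 : ∀ x, χ x ≤ 1)
    {δ : ℝ} (hδ : ∀ x, ‖(∇ χ) x‖ ≤ δ) :
    ∫ x, χ x * b (θ T x) ≤ (∫ x, χ x * b (θ₀ x))
      + δ * (∫ s in Ioc 0 T, (κ * (M * gradientBound G s) + N * (M * U))) := by
  have hum := hu.measurable.mono_measure (Ioc_prod_le_Ioi_prod (T := T))
  have t1 := tendsto_integral_renormalized_mollify hb hχ (hθ.memLp T hT)
  have t2 := tendsto_integral_renormalized_mollify hb hχ hθ₀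
  have t3 : Tendsto (fun n => ∫ s in Ioc 0 T,
      (eLpNorm (commutator (shrinkingBump d n) (u s) (G s)) 1 volume).toReal) atTop
      (𝓝 (∫ s in Ioc 0 T, (0 : ℝ))) := by
    refine tendsto_integral_of_dominated_convergence (fun s => 2 * (U * gradientBound G s))
      (fun n => aestronglyMeasurable_norm_commutator hum hG.1 _)
      (((integrable_gradientBound hG).const_mul U).const_mul 2) (fun n => ?_) ?_
    · filter_upwards [ae_Ioc_of_ae_Ioi hu.memLp, hU, ae_memLp_gradient hG] with s h1 h2 h3
      exact norm_commutator_le h1 h3 h2 _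
    · filter_upwards [ae_Ioc_of_ae_Ioi hu.memLp, ae_memLp_gradient hG] with s h1 h3
      exact (ENNReal.tendsto_toReal ENNReal.zero_ne_top).comp (tendsto_eLpNorm_commutator h1 h3)
  rw [integral_zero] at t3
  have t4 := t2.add ((t3.const_mul (N : ℝ)).const_add
    (δ * (∫ s in Ioc 0 T, (κ * (M * gradientBound G s) + N * (M * U)))))
  rw [mul_zero, add_zero] at t4
  exact le_of_tendsto_of_tendsto' t1 t4 fun n =>
    hθ.integral_renormalized_mollify_le hT hκ hu hU hθ₀ hM hG hGw _ hb hχ hχ0 hχ1 hδ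

lemma tendsto_integral_cutoff_mul {g : Rd d → ℝ} (hg : Integrable g) :
    Tendsto (fun n => ∫ x, cutoff d n x * g x) atTop (𝓝 (∫ x, g x)) := by
  refine tendsto_integral_of_dominated_convergence (fun x => ‖g x‖)
    (fun n => (isTestFunction_cutoff n).continuous.aestronglyMeasurable.mul hg.1) hg.norm
    (fun n => Eventually.of_forall fun x => ?_) (Eventually.of_forall fun x => ?_)
  · rw [norm_mul, Real.norm_of_nonneg (cutoff_nonneg n x)]
    exact mul_le_of_le_one_left (norm_nonneg _) (cutoff_le_one n x)
  · simpa using (tendsto_cutoff x).mul_const (g x)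

lemma IsRenormalization.integrable_comp {N : NNReal} {b : ℝ → ℝ} (hb : IsRenormalization N b)
    {f : Rd d → ℝ} (hf : MemLp f 2 volume) : Integrable (fun x => b (f x)) := by
  refine (hf.integrable_sq.div_const 2).mono (hb.smooth.continuous.comp_aestronglyMeasurable hf.1)
    (Eventually.of_forall fun x => ?_)
  rw [Real.norm_of_nonneg (hb.nonneg _), Real.norm_of_nonneg (by positivity)]
  exact hb.le_sq _

/-- The `L²` norm of a weak solution does not exceed that of the initial datum. -/
theorem IsWeakSolution.l2Norm_le (hκ : 0 ≤ κ) (hu : IsVelocityField u)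
    (hU : ∀ T, ∃ U, ∀ᵐ s ∂(volume.restrict (Ioc 0 T)), l2Norm (u s) ≤ U)
    (hθ : IsWeakSolution κ u θ₀ θ) (hθ₀ : MemLp θ₀ 2 volume) {T : ℝ} (hT : 0 < T) :
    l2Norm (θ T) ≤ l2Norm θ₀ := by
  obtain ⟨G, hG, hGw⟩ := hθ.gradient
  obtain ⟨M, hM⟩ := hθ.bounded T hT
  obtain ⟨U, hU⟩ := hU T
  have hθT := hθ.memLp T hT.le
  obtain ⟨c, hc0, hc⟩ := exists_norm_gradient_cutoff_le d
  have hren : ∀ (N : NNReal) (b : ℝ → ℝ), IsRenormalization N b →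
      ∫ x, b (θ T x) ≤ ∫ x, b (θ₀ x) := by
    intro N b hb
    have t1 := tendsto_integral_cutoff_mul (hb.integrable_comp hθT)
    have t2 := tendsto_integral_cutoff_mul (hb.integrable_comp hθ₀)
    have t3 := t2.add (((tendsto_one_div_add_atTop_nhds_zero_nat (𝕜 := ℝ)).const_mul c).mul_const
      (∫ s in Ioc 0 T, (κ * (M * gradientBound G s) + N * (M * U))))
    rw [mul_zero, zero_mul, add_zero] at t3
    exact le_of_tendsto_of_tendsto' t1 t3 fun n =>
      hθ.integral_cutoff_renormalized_le hT.le hκ hu hU hθ₀ hM (hG T hT) hGw hb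
        (isTestFunction_cutoff n) (cutoff_nonneg n) (cutoff_le_one n) (hc n)
  have hlim : ∀ {f : Rd d → ℝ}, MemLp f 2 volume →
      Tendsto (fun n : ℕ => ∫ x, truncatedSquare ((n : ℝ) + 1) (f x)) atTop
        (𝓝 (∫ x, f x ^ 2 / 2)) := by
    intro f hf
    have hb : ∀ n : ℕ, IsRenormalization ((n : NNReal) + 1) (truncatedSquare ((n : ℝ) + 1)) :=
      fun n => isRenormalization_truncatedSquare (by positivity)
    refine tendsto_integral_of_dominated_convergence (fun x => f x ^ 2 / 2)
      (fun n => ((hb n).integrable_comp hf).1) (hf.integrable_sq.div_const 2)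
      (fun n => Eventually.of_forall fun x => ?_)
      (Eventually.of_forall fun x => tendsto_truncatedSquare _)
    rw [Real.norm_of_nonneg ((hb n).nonneg _)]
    exact (hb n).le_sq _
  have hle := le_of_tendsto_of_tendsto' (hlim hθT) (hlim hθ₀) fun n =>
    hren ((n : NNReal) + 1) _ (isRenormalization_truncatedSquare (by positivity))
  rw [integral_div, integral_div] at hle
  have hsq : l2Norm (θ T) ^ 2 ≤ l2Norm θ₀ ^ 2 := by
    rw [l2Norm_sq hθT, l2Norm_sq hθ₀]
    simp only [Real.norm_eq_abs, sq_abs]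
    linarith
  exact (pow_le_pow_iff_left₀ (l2Norm_nonneg _) (l2Norm_nonneg _) two_ne_zero).1 hsq

end EnergyInequality

/-! ### Schwartz and band-limited test functions -/

section SchwartzTest

variable {d : ℕ}

lemma laplacian_mul {f g : Rd d → ℝ} (hf : ContDiff ℝ 2 f) (hg : ContDiff ℝ 2 g) (x : Rd d) :
    (Δ (fun y => f y * g y)) x
      = f x * (Δ g) x + 2 * ⟪(∇ f) x, (∇ g) x⟫ + g x * (Δ f) x := by
  have hfd : Differentiable ℝ f := hf.differentiable two_ne_zero
  have hgd : Differentiable ℝ g := hg.differentiable two_ne_zero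
  have hd1 : ∀ (k : Rd d → ℝ) (_ : ContDiff ℝ 2 k) e,
      DifferentiableAt ℝ (fun z => fderiv ℝ k z e) x := fun k hk e =>
    ((hk.fderiv_right (m := 1) (by norm_num)).clm_apply contDiff_const).differentiable
      one_ne_zero x
  have hinner : ⟪(∇ f) x, (∇ g) x⟫ = ∑ i, fderiv ℝ f x (EuclideanSpace.basisFun (Fin d) ℝ i) *
      fderiv ℝ g x (EuclideanSpace.basisFun (Fin d) ℝ i) := by
    rw [← (EuclideanSpace.basisFun (Fin d) ℝ).sum_inner_mul_inner]
    refine Finset.sum_congr rfl fun i _ => ?_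
    rw [inner_gradient_left, inner_gradient_right, conj_trivial]
  rw [laplacian_eq_sum_fderiv (hf.mul hg), laplacian_eq_sum_fderiv hf, laplacian_eq_sum_fderiv hg,
    hinner, Finset.mul_sum, Finset.mul_sum, Finset.mul_sum, ← Finset.sum_add_distrib,
    ← Finset.sum_add_distrib]
  refine Finset.sum_congr rfl fun i _ => ?_
  have h1 : ∀ z e, fderiv ℝ (fun y => f y * g y) z e
      = f z * fderiv ℝ g z e + g z * fderiv ℝ f z e := fun z e => by
    rw [fderiv_fun_mul (hfd z) (hgd z)]; simp
  simp_rw [h1]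
  rw [fderiv_fun_add ((hfd x).fun_mul (hd1 g hg _)) ((hgd x).fun_mul (hd1 f hf _)),
    fderiv_fun_mul (hfd x) (hd1 g hg _), fderiv_fun_mul (hgd x) (hd1 f hf _)]
  simp only [add_apply, smul_apply, smul_eq_mul]
  ring

variable {u : ℝ → Rd d → Rd d} {θ : ℝ → Rd d → ℝ} {θ₀ : Rd d → ℝ} {κ : ℝ}

lemma contDiff_schwartz (f : 𝓢(Rd d, ℝ)) : ContDiff ℝ ∞ f := f.smooth ⊤

lemma memLp_laplacian_schwartz (f : 𝓢(Rd d, ℝ)) : MemLp (Δ (f : Rd d → ℝ)) 2 volume := by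
  have : (Δ (f : Rd d → ℝ)) = ((Δ f : 𝓢(Rd d, ℝ)) : Rd d → ℝ) :=
    funext fun x => (SchwartzMap.laplacian_apply f x).symm
  rw [this]
  exact (Δ f : 𝓢(Rd d, ℝ)).memLp 2

lemma exists_norm_gradient_schwartz_le (f : 𝓢(Rd d, ℝ)) : ∃ c, ∀ x, ‖(∇ f) x‖ ≤ c :=
  ⟨_, fun x => by
    rw [norm_gradient]
    exact (SchwartzMap.fderivCLM ℝ (Rd d) ℝ f).norm_le_seminorm ℝ x⟩

lemma memLp_norm_gradient_schwartz (f : 𝓢(Rd d, ℝ)) : MemLp (fun x => ‖(∇ f) x‖) 2 volume := by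
  simp_rw [norm_gradient]
  exact ((SchwartzMap.fderivCLM ℝ (Rd d) ℝ f).memLp 2).norm

/-- The flux of a Schwartz function is the limit of the fluxes of its truncations. -/
lemma tendsto_flux_cutoff {g : Rd d → ℝ} {v : Rd d → Rd d} (hg : MemLp g 2 volume)
    (hv : MemLp v 2 volume) (f : 𝓢(Rd d, ℝ)) {c : ℝ} {D : Rd d → ℝ} (hD : MemLp D 2 volume)
    (hc : ∀ n x, ‖(∇ (fun y => cutoff d n y * f y)) x‖ ≤ c)
    (hDn : ∀ n x, |(Δ (fun y => cutoff d n y * f y)) x| ≤ D x) :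
    Tendsto (fun n => flux κ g v (fun y => cutoff d n y * f y)) atTop (𝓝 (flux κ g v f)) := by
  have hfs := contDiff_schwartz f
  have hψ : ∀ n, IsTestFunction (fun y => cutoff d n y * f y) := fun n => by
    simpa [mul_comm] using (isTestFunction_cutoff n).mul_left hfs
  refine tendsto_integral_of_dominated_convergence
    (fun x => ‖g x‖ * ‖|κ| * D x‖ + c * (‖g x‖ * ‖v x‖)) (fun n => ?_)
    ((integrable_norm_mul_norm hg (hD.const_mul |κ|)).add
      ((integrable_norm_mul_norm hg hv).const_mul c))
    (fun n => Eventually.of_forall fun x => ?_) (Eventually.of_forall fun x => ?_)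
  · exact hg.1.mul (((hψ n).continuous_laplacian.aestronglyMeasurable.const_mul κ).add
      (hv.1.inner (hψ n).continuous_gradient.aestronglyMeasurable))
  · have hD0 : 0 ≤ D x := (abs_nonneg _).trans (hDn n x)
    rw [norm_mul]
    have h1 : ‖κ * (Δ (fun y => cutoff d n y * f y)) x
        + ⟪v x, (∇ (fun y => cutoff d n y * f y)) x⟫‖ ≤ ‖|κ| * D x‖ + ‖v x‖ * c := by
      refine (norm_add_le _ _).trans ?_
      rw [norm_mul, norm_mul, Real.norm_of_nonneg (abs_nonneg κ), Real.norm_of_nonneg hD0]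
      refine add_le_add ?_ ?_
      · rw [Real.norm_eq_abs, Real.norm_eq_abs]
        gcongr
        exact hDn n x
      · exact (norm_inner_le_norm _ _).trans (by gcongr; exact hc n x)
    calc _ ≤ ‖g x‖ * (‖|κ| * D x‖ + ‖v x‖ * c) := by gcongr
      _ = _ := by ring
  · refine tendsto_const_nhds.congr' ?_
    filter_upwards [cutoff_eventuallyEq_one x] with n hn
    have he : (fun y => cutoff d n y * f y) =ᶠ[𝓝 x] f := by
      filter_upwards [hn] with y hy
      simp [hy]
    rw [he.gradient_eq, (InnerProductSpace.laplacian_congr_nhds he).eq_of_nhds]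

/-- The weak formulation holds for Schwartz test functions. -/
lemma IsWeakSolution.equation_schwartz (hκ : 0 ≤ κ) (hu : IsVelocityField u)
    (hθ : IsWeakSolution κ u θ₀ θ) (hθ₀ : MemLp θ₀ 2 volume) {t U : ℝ} (ht : 0 < t)
    (hU : ∀ᵐ s ∂(volume.restrict (Ioc 0 t)), l2Norm (u s) ≤ U) (f : 𝓢(Rd d, ℝ)) :
    ∫ x, θ t x * f x = (∫ x, θ₀ x * f x) + ∫ s in (0 : ℝ)..t, flux κ (θ s) (u s) f := by
  have hfs := contDiff_schwartz f
  have hψ : ∀ n, IsTestFunction (fun y => cutoff d n y * f y) := fun n => by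
    simpa [mul_comm] using (isTestFunction_cutoff n).mul_left hfs
  obtain ⟨c₁, hc₁0, hc₁'⟩ := exists_norm_gradient_cutoff_le d
  have hc₁ : ∀ n (x : Rd d), ‖(∇ (cutoff d n)) x‖ ≤ c₁ := fun n x =>
    (hc₁' n x).trans (mul_le_of_le_one_right hc₁0 (by
      rw [div_le_one (by positivity)]; linarith [Nat.cast_nonneg (α := ℝ) n]))
  obtain ⟨c₂, hc₂0, hc₂⟩ := exists_abs_laplacian_cutoff_le d
  obtain ⟨c₃, hc₃⟩ := exists_norm_gradient_schwartz_le f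
  have hf2 : ContDiff ℝ 2 f := f.smooth 2
  have hcut2 : ∀ n, ContDiff ℝ 2 (cutoff d n) := fun n => (isTestFunction_cutoff n).contDiff (n := 2)
  set D : Rd d → ℝ := fun x => |(Δ (f : Rd d → ℝ)) x| + 2 * (c₁ * ‖(∇ f) x‖) + c₂ * |f x| with hD
  have hDL : MemLp D 2 volume :=
    ((memLp_laplacian_schwartz f).abs.add (((memLp_norm_gradient_schwartz f).const_mul c₁).const_mul 2)).add
      ((f.memLp 2 volume).abs.const_mul c₂)
  have hDn : ∀ n x, |(Δ (fun y => cutoff d n y * f y)) x| ≤ D x := by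
    intro n x
    rw [laplacian_mul (hcut2 n) hf2]
    refine (abs_add_three _ _ _).trans ?_
    rw [abs_mul, abs_mul, abs_mul, abs_of_nonneg (cutoff_nonneg n x), abs_two, mul_comm |f x|]
    refine add_le_add (add_le_add ?_ ?_) ?_
    · exact mul_le_of_le_one_left (abs_nonneg _) (cutoff_le_one n x)
    · have := (abs_real_inner_le_norm ((∇ (cutoff d n)) x) ((∇ f) x)).trans
        (mul_le_mul_of_nonneg_right (hc₁ n x) (norm_nonneg _))
      linarith
    · exact mul_le_mul_of_nonneg_right (hc₂ n x) (abs_nonneg _)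
  set c := c₁ * SchwartzMap.seminorm ℝ 0 0 f + c₃ with hc
  have hcn : ∀ n x, ‖(∇ (fun y => cutoff d n y * f y)) x‖ ≤ c := by
    intro n x
    rw [gradient_mul ((hcut2 n).differentiable two_ne_zero x) (hf2.differentiable two_ne_zero x),
      add_comm]
    refine (norm_add_le _ _).trans (add_le_add ?_ ?_)
    · rw [norm_smul, mul_comm]
      exact mul_le_mul (hc₁ n x) (f.norm_le_seminorm ℝ x) (norm_nonneg _) hc₁0
    · rw [norm_smul, Real.norm_of_nonneg (cutoff_nonneg n x)]
      exact (mul_le_of_le_one_left (norm_nonneg _) (cutoff_le_one n x)).trans (hc₃ x)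
  obtain ⟨M, hM⟩ := hθ.bounded t ht
  have hmem : ∀ᵐ s ∂(volume.restrict (Ioc 0 t)), s ∈ Ioc 0 t := ae_restrict_mem measurableSet_Ioc
  have hpair : ∀ {g : Rd d → ℝ}, MemLp g 2 volume → Tendsto
      (fun n => ∫ x, g x * (cutoff d n x * f x)) atTop (𝓝 (∫ x, g x * f x)) := by
    intro g hg
    have := tendsto_integral_cutoff_mul (hg.integrable_mul (f.memLp 2 volume))
    simpa [mul_left_comm] using this
  have t1 := hpair (hθ.memLp t ht.le)
  have t2 := hpair hθ₀
  have hum := hu.measurable.mono_measure (Ioc_prod_le_Ioi_prod (T := t))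
  have hθm := hθ.measurable.mono_measure (Ioc_prod_le_Ioi_prod (T := t))
  have t3 : Tendsto (fun n => ∫ s in Ioc 0 t, flux κ (θ s) (u s) (fun y => cutoff d n y * f y))
      atTop (𝓝 (∫ s in Ioc 0 t, flux κ (θ s) (u s) f)) := by
    refine tendsto_integral_of_dominated_convergence
      (fun _ => κ * (M * l2Norm D) + c * (M * U))
      (fun n => aestronglyMeasurable_flux hθm hum ((hψ n).contDiff (n := 2)))
      (integrable_const _) (fun n => ?_) ?_
    · filter_upwards [hmem, ae_Ioc_of_ae_Ioi hu.memLp, hU] with s hs h1 h2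
      have hΔ : MemLp (Δ (fun y => cutoff d n y * f y)) 2 volume :=
        hDL.mono (hψ n).continuous_laplacian.aestronglyMeasurable
          (Eventually.of_forall fun x => (hDn n x).trans (le_abs_self _))
      have hΔD : l2Norm (Δ (fun y => cutoff d n y * f y)) ≤ l2Norm D :=
        ENNReal.toReal_mono hDL.2.ne (eLpNorm_mono fun x => (hDn n x).trans (le_abs_self _))
      refine (abs_flux_le hκ (hθ.memLp s hs.1.le) h1 hΔ (hcn n)).trans ?_
      have h3 := hM s (Ioc_subset_Icc_self hs)
      have h4 := l2Norm_nonneg (θ s)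
      have h5 := l2Norm_nonneg (u s)
      have h6 := l2Norm_nonneg (Δ (fun y => cutoff d n y * f y))
      have h7 : 0 ≤ c := (norm_nonneg _).trans (hcn 0 0)
      have h8 : 0 ≤ M := h4.trans h3
      gcongr
    · filter_upwards [hmem, ae_Ioc_of_ae_Ioi hu.memLp] with s hs h1
      exact tendsto_flux_cutoff (hθ.memLp s hs.1.le) h1 f hDL hcn hDn
  have heq : ∀ n, ∫ x, θ t x * (cutoff d n x * f x) = (∫ x, θ₀ x * (cutoff d n x * f x))
      + ∫ s in Ioc 0 t, flux κ (θ s) (u s) (fun y => cutoff d n y * f y) := by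
    intro n
    rw [← intervalIntegral.integral_of_le ht.le]
    exact hθ.equation t ht.le _ (hψ n)
  rw [intervalIntegral.integral_of_le ht.le]
  refine tendsto_nhds_unique t1 ?_
  simp_rw [heq]
  exact t2.add t3

end SchwartzTest

section BandLimited

variable {d : ℕ}

/-- Schwartz functions whose Fourier transform vanishes outside the closed ball of radius `ρ`. -/
def IsBandLimited (ρ : ℝ) (f : 𝓢(Rd d, ℂ)) : Prop := ∀ ξ, ρ < ‖ξ‖ → 𝓕 f ξ = 0

/-- The real part of a Schwartz function. -/
def schwartzRe (f : 𝓢(Rd d, ℂ)) : 𝓢(Rd d, ℝ) := f.postcompCLM (𝕜 := ℝ) Complex.reCLM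

variable {ρ : ℝ} {f : 𝓢(Rd d, ℂ)}

lemma schwartzRe_apply (f : 𝓢(Rd d, ℂ)) (x : Rd d) : schwartzRe f x = (f x).re := rfl

lemma l2Norm_fourier_schwartz (f : 𝓢(Rd d, ℂ)) : l2Norm (𝓕 f : 𝓢(Rd d, ℂ)) = l2Norm f := by
  have h : l2Norm (𝓕 f : 𝓢(Rd d, ℂ)) ^ 2 = l2Norm f ^ 2 := by
    rw [l2Norm_sq ((𝓕 f : 𝓢(Rd d, ℂ)).memLp 2 volume), l2Norm_sq (f.memLp 2 volume)]
    exact SchwartzMap.integral_norm_sq_fourier f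
  exact (pow_left_inj₀ (l2Norm_nonneg _) (l2Norm_nonneg _) two_ne_zero).1 h

lemma l2Norm_schwartzRe_le (f : 𝓢(Rd d, ℂ)) : l2Norm (schwartzRe f) ≤ l2Norm f :=
  ENNReal.toReal_mono (f.memLp 2 volume).2.ne <| eLpNorm_mono fun x => by
    rw [schwartzRe_apply, Real.norm_eq_abs]
    exact Complex.abs_re_le_norm _

lemma laplacian_schwartzRe (f : 𝓢(Rd d, ℂ)) (x : Rd d) :
    (Δ (schwartzRe f : Rd d → ℝ)) x = schwartzRe (Δ f) x := by
  rw [schwartzRe_apply, SchwartzMap.laplacian_apply]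
  exact ((f.smooth 2).contDiffAt (x := x)).laplacian_CLM_comp_left (l := Complex.reCLM)

lemma fourier_laplacian_apply (f : 𝓢(Rd d, ℂ)) (ξ : Rd d) :
    𝓕 (Δ f : 𝓢(Rd d, ℂ)) ξ = -(2 * Real.pi) ^ 2 • ((‖ξ‖ ^ 2 : ℝ) • 𝓕 f ξ) := by
  rw [SchwartzMap.laplacian_eq_fourierMultiplierCLM, SchwartzMap.fourierMultiplierCLM_apply,
    FourierTransform.fourier_smul, FourierTransform.fourier_fourierInv_eq, smul_apply,
    SchwartzMap.smulLeftCLM_apply_apply (by fun_prop)]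

lemma IsBandLimited.laplacian (hf : IsBandLimited ρ f) : IsBandLimited ρ (Δ f) := fun ξ hξ => by
  rw [fourier_laplacian_apply, hf ξ hξ, smul_zero, smul_zero]

lemma IsBandLimited.l2Norm_laplacian_le (hf : IsBandLimited ρ f) :
    l2Norm (Δ f : 𝓢(Rd d, ℂ)) ≤ (2 * Real.pi * ρ) ^ 2 * l2Norm f := by
  rw [← l2Norm_fourier_schwartz, ← l2Norm_fourier_schwartz f]
  have hpt : ∀ ξ, ‖𝓕 (Δ f : 𝓢(Rd d, ℂ)) ξ‖ ≤ (2 * Real.pi * ρ) ^ 2 * ‖𝓕 f ξ‖ := by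
    intro ξ
    rcases lt_or_ge ρ ‖ξ‖ with h | h
    · rw [hf.laplacian ξ h, hf ξ h]; simp
    · rw [fourier_laplacian_apply, norm_smul, norm_smul, norm_neg,
        Real.norm_of_nonneg (by positivity), Real.norm_of_nonneg (by positivity)]
      calc (2 * Real.pi) ^ 2 * (‖ξ‖ ^ 2 * ‖𝓕 f ξ‖)
          ≤ (2 * Real.pi) ^ 2 * (ρ ^ 2 * ‖𝓕 f ξ‖) := by gcongr
        _ = _ := by ring
  have h : eLpNorm (𝓕 (Δ f : 𝓢(Rd d, ℂ)) : 𝓢(Rd d, ℂ)) 2 volume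
      ≤ ENNReal.ofReal ((2 * Real.pi * ρ) ^ 2) * eLpNorm (𝓕 f : 𝓢(Rd d, ℂ)) 2 volume :=
    eLpNorm_le_mul_eLpNorm_of_ae_le_mul (Eventually.of_forall hpt) 2
  have h2 := ENNReal.toReal_mono (ENNReal.mul_ne_top ENNReal.ofReal_ne_top
    ((𝓕 f : 𝓢(Rd d, ℂ)).memLp 2 volume).2.ne) h
  rwa [ENNReal.toReal_mul, ENNReal.toReal_ofReal (by positivity)] at h2

lemma IsBandLimited.integral_norm_fourier_le (hf : IsBandLimited ρ f) :
    ∫ ξ, ‖𝓕 f ξ‖ ≤ √(volume.real (Metric.closedBall (0 : Rd d) ρ)) * l2Norm f := by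
  set B := Metric.closedBall (0 : Rd d) ρ with hB
  have hBf : volume B ≠ ⊤ := measure_closedBall_lt_top.ne
  have hBm : MeasurableSet B := Metric.isClosed_closedBall.measurableSet
  have hi : MemLp (B.indicator fun _ => (1 : ℝ)) 2 volume := memLp_indicator_const 2 hBm 1 (Or.inr hBf)
  have hl : l2Norm (B.indicator fun _ => (1 : ℝ)) = √(volume.real B) := by
    rw [← Real.sqrt_sq (l2Norm_nonneg _), l2Norm_sq hi]
    congr 1
    have : ∀ x, ‖B.indicator (fun _ => (1 : ℝ)) x‖ ^ 2 = B.indicator (fun _ => (1 : ℝ)) x := by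
      intro x; by_cases hx : x ∈ B <;> simp [hx]
    simp_rw [this]
    rw [integral_indicator hBm]; simp
  have h := integral_norm_mul_norm_le hi ((𝓕 f : 𝓢(Rd d, ℂ)).memLp 2 volume)
  have h2 : ∀ ξ, ‖B.indicator (fun _ => (1 : ℝ)) ξ‖ * ‖(𝓕 f : 𝓢(Rd d, ℂ)) ξ‖ = ‖𝓕 f ξ‖ := by
    intro ξ
    by_cases hx : ξ ∈ B
    · simp [hx]
    · rw [hf ξ (by simpa [hB] using hx)]; simp
  simp_rw [h2] at h
  refine h.trans (le_of_eq ?_)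
  rw [← hl, ← l2Norm_fourier_schwartz f]
  rfl

lemma IsBandLimited.norm_lineDeriv_le (hρ : 0 ≤ ρ) (hf : IsBandLimited ρ f) (e x : Rd d) :
    ‖fderiv ℝ f x e‖
      ≤ 2 * Real.pi * ρ * (√(volume.real (Metric.closedBall (0 : Rd d) ρ)) * l2Norm f) * ‖e‖ := by
  have h1 : fderiv ℝ f x e = 𝓕⁻ (𝓕 (∂_{e} f : 𝓢(Rd d, ℂ)) : 𝓢(Rd d, ℂ)) x := by
    rw [FourierTransform.fourierInv_fourier_eq]; rfl
  have h2 : ‖𝓕⁻ (𝓕 (∂_{e} f : 𝓢(Rd d, ℂ)) : 𝓢(Rd d, ℂ)) x‖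
      ≤ ∫ ξ, ‖(𝓕 (∂_{e} f : 𝓢(Rd d, ℂ)) : 𝓢(Rd d, ℂ)) ξ‖ := by
    rw [SchwartzMap.fourierInv_apply_eq, SchwartzMap.compCLMOfContinuousLinearEquiv_apply]
    refine (SchwartzMap.norm_fourier_apply_le_toLp_one _ _).trans ?_
    rw [SchwartzMap.norm_toLp_one]
  have h3 : ∀ ξ, ‖(𝓕 (∂_{e} f : 𝓢(Rd d, ℂ)) : 𝓢(Rd d, ℂ)) ξ‖
      ≤ 2 * Real.pi * ρ * ‖e‖ * ‖𝓕 f ξ‖ := by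
    intro ξ
    rw [SchwartzMap.fourier_lineDerivOp_eq, smul_apply,
      SchwartzMap.smulLeftCLM_apply_apply (by fun_prop), norm_smul, norm_smul]
    rcases lt_or_ge ρ ‖ξ‖ with h | h
    · rw [hf ξ h]; simp
    · have h4 : ‖(2 * Real.pi * Complex.I : ℂ)‖ = 2 * Real.pi := by
        simp [abs_of_pos Real.pi_pos]
      rw [h4, ← mul_assoc]
      have h5 : ‖inner ℝ ξ e‖ ≤ ρ * ‖e‖ := (norm_inner_le_norm _ _).trans (by gcongr)
      have := Real.pi_pos
      calc 2 * Real.pi * ‖inner ℝ ξ e‖ * ‖𝓕 f ξ‖ ≤ 2 * Real.pi * (ρ * ‖e‖) * ‖𝓕 f ξ‖ := by gcongr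
        _ = _ := by ring
  have := Real.pi_pos
  calc ‖fderiv ℝ f x e‖ ≤ ∫ ξ, ‖(𝓕 (∂_{e} f : 𝓢(Rd d, ℂ)) : 𝓢(Rd d, ℂ)) ξ‖ := by rw [h1]; exact h2
    _ ≤ ∫ ξ, 2 * Real.pi * ρ * ‖e‖ * ‖𝓕 f ξ‖ :=
        integral_mono ((𝓕 (∂_{e} f : 𝓢(Rd d, ℂ)) : 𝓢(Rd d, ℂ)).integrable.norm)
          ((𝓕 f : 𝓢(Rd d, ℂ)).integrable.norm.const_mul _) h3
    _ = 2 * Real.pi * ρ * ‖e‖ * ∫ ξ, ‖𝓕 f ξ‖ := integral_const_mul _ _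
    _ ≤ 2 * Real.pi * ρ * ‖e‖ * (√(volume.real (Metric.closedBall (0 : Rd d) ρ)) * l2Norm f) := by
        gcongr; exact hf.integral_norm_fourier_le
    _ = _ := by ring

lemma IsBandLimited.norm_gradient_re_le (hρ : 0 ≤ ρ) (hf : IsBandLimited ρ f) (x : Rd d) :
    ‖(∇ (schwartzRe f : Rd d → ℝ)) x‖
      ≤ 2 * Real.pi * ρ * (√(volume.real (Metric.closedBall (0 : Rd d) ρ)) * l2Norm f) := by
  have := Real.pi_pos
  have := l2Norm_nonneg f
  rw [norm_gradient]
  refine ContinuousLinearMap.opNorm_le_bound _ (by positivity) fun e => ?_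
  have h1 : fderiv ℝ (schwartzRe f : Rd d → ℝ) x e = (fderiv ℝ f x e).re := by
    have := (Complex.reCLM.hasFDerivAt.comp x (f.hasFDerivAt x)).fderiv
    rw [show (schwartzRe f : Rd d → ℝ) = Complex.reCLM ∘ f from rfl, this]
    rfl
  rw [h1]
  exact (Complex.abs_re_le_norm _).trans (hf.norm_lineDeriv_le hρ e x)

end BandLimited

/-! ### Stability of the low frequencies -/

section LowFrequency

variable {d : ℕ}

/-- The best constant in a family of linear bounds is attained. -/
lemma exists_least_const {ι : Type*} {a b : ι → ℝ} (hb : ∀ i, 0 ≤ b i)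
    (h : ∃ K, 0 ≤ K ∧ ∀ i, a i ≤ K * b i) :
    ∃ K₀, 0 ≤ K₀ ∧ (∀ i, a i ≤ K₀ * b i) ∧ ∀ K, 0 ≤ K → (∀ i, a i ≤ K * b i) → K₀ ≤ K := by
  set S := {K | 0 ≤ K ∧ ∀ i, a i ≤ K * b i} with hS
  have hne : S.Nonempty := h
  have hbd : BddBelow S := ⟨0, fun K hK => hK.1⟩
  refine ⟨sInf S, le_csInf hne fun K hK => hK.1, fun i => ?_, fun K h0 hK => csInf_le hbd ⟨h0, hK⟩⟩
  rcases (hb i).eq_or_lt with h0 | h0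
  · obtain ⟨K, hK⟩ := hne
    have := hK.2 i
    rw [← h0] at this ⊢
    simpa using this
  · rw [← div_le_iff₀ h0]
    exact le_csInf hne fun K hK => (div_le_iff₀ h0).2 (hK.2 i)

lemma abs_flux_le_pairing {κ : ℝ} {g : Rd d → ℝ} {v : Rd d → Rd d} (hκ : 0 ≤ κ)
    (hg : MemLp g 2 volume) (hv : MemLp v 2 volume) (f : 𝓢(Rd d, ℝ)) {c : ℝ}
    (hc : ∀ x, ‖(∇ f) x‖ ≤ c) :
    |flux κ g v f| ≤ κ * |∫ x, g x * (Δ (f : Rd d → ℝ)) x| + c * (l2Norm g * l2Norm v) := by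
  have hc0 : 0 ≤ c := (norm_nonneg _).trans (hc 0)
  have hgc := continuous_gradient (f.smooth 1)
  have i1 : Integrable (fun x => g x * (Δ (f : Rd d → ℝ)) x) :=
    hg.integrable_mul (memLp_laplacian_schwartz f)
  have i2 := (integrable_norm_mul_norm hg hv).const_mul c
  have hle : ∀ x, ‖g x * ⟪v x, (∇ f) x⟫‖ ≤ c * (‖g x‖ * ‖v x‖) := fun x => by
    rw [norm_mul]
    calc ‖g x‖ * ‖⟪v x, (∇ f) x⟫‖ ≤ ‖g x‖ * (‖v x‖ * c) := by
          gcongr; exact (norm_inner_le_norm _ _).trans (by gcongr; exact hc x)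
      _ = _ := by ring
  have i3 : Integrable (fun x => g x * ⟪v x, (∇ f) x⟫) :=
    i2.mono' (hg.1.mul (hv.1.inner hgc.aestronglyMeasurable)) (Eventually.of_forall hle)
  have hsplit : flux κ g v f = κ * (∫ x, g x * (Δ (f : Rd d → ℝ)) x)
      + ∫ x, g x * ⟪v x, (∇ f) x⟫ := by
    rw [flux, ← integral_const_mul, ← integral_add (i1.const_mul κ) i3]
    congr 1; ext x; ring
  rw [hsplit]
  refine (abs_add_le _ _).trans (add_le_add ?_ ?_)
  · rw [abs_mul, abs_of_nonneg hκ]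
  · rw [← Real.norm_eq_abs]
    refine (norm_integral_le_integral_norm _).trans ?_
    calc ∫ x, ‖g x * ⟪v x, (∇ f) x⟫‖ ≤ ∫ x, c * (‖g x‖ * ‖v x‖) :=
          integral_mono_of_nonneg (Eventually.of_forall fun _ => norm_nonneg _) i2
            (Eventually.of_forall hle)
      _ = c * ∫ x, ‖g x‖ * ‖v x‖ := integral_const_mul _ _
      _ ≤ _ := by gcongr; exact integral_norm_mul_norm_le hg hv

lemma abs_integral_mul_schwartzRe_le {g : Rd d → ℝ} (hg : MemLp g 2 volume) (f : 𝓢(Rd d, ℂ)) :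
    |∫ x, g x * schwartzRe f x| ≤ l2Norm g * l2Norm f := by
  rw [← Real.norm_eq_abs]
  refine (norm_integral_le_integral_norm _).trans ?_
  simp_rw [norm_mul]
  refine (integral_norm_mul_norm_le hg ((schwartzRe f).memLp 2 volume)).trans ?_
  have := l2Norm_schwartzRe_le f
  have h2 := l2Norm_nonneg g
  change l2Norm g * l2Norm (schwartzRe f) ≤ _
  gcongr

variable {u : ℝ → Rd d → Rd d} {θ : ℝ → Rd d → ℝ} {θ₀ : Rd d → ℝ} {κ : ℝ}

/-- Low-frequency stability: if diffusion is negligible at frequencies below `ρ` up to time `t`,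
then a weak solution keeps most of the low-frequency content of its initial datum, up to the
contribution of the transport term. -/
lemma IsWeakSolution.low_frequency_lower_bound (hκ : 0 ≤ κ) (hu : IsVelocityField u)
    (hθ : IsWeakSolution κ u θ₀ θ) (hθ₀ : MemLp θ₀ 2 volume) {t U : ℝ} (ht : 0 < t)
    (hU : ∀ᵐ s ∂(volume.restrict (Ioc 0 t)), l2Norm (u s) ≤ U)
    {w : ℝ → ℝ} (hw : IntegrableOn w (Ioc 0 t))
    (huw : ∀ᵐ s ∂(volume.restrict (Ioc 0 t)), l2Norm (u s) ≤ w s)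
    (hE : ∀ s, 0 < s → l2Norm (θ s) ≤ l2Norm θ₀) {ρ : ℝ} (hρ : 0 ≤ ρ)
    (hq : κ * (2 * Real.pi * ρ) ^ 2 * t ≤ 1 / 4) {f : 𝓢(Rd d, ℂ)} (hf : IsBandLimited ρ f)
    (hf0 : 0 < l2Norm f) {n₀ : ℝ} (hn₀ : n₀ * l2Norm f ≤ ∫ x, θ₀ x * schwartzRe f x) :
    2 / 3 * n₀ ≤ l2Norm (θ t) + 4 / 3 * (2 * Real.pi * ρ *
      √(volume.real (Metric.closedBall (0 : Rd d) ρ)) * (l2Norm θ₀ * ∫ s in Ioc 0 t, w s)) := by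
  set B := √(volume.real (Metric.closedBall (0 : Rd d) ρ)) with hB
  set E := l2Norm θ₀ with hEdef
  set W := ∫ s in Ioc 0 t, w s with hW
  have hE0 : 0 ≤ E := l2Norm_nonneg _
  have hπ := Real.pi_pos
  have hB0 : 0 ≤ B := Real.sqrt_nonneg _
  have hw0 : ∀ᵐ s ∂(volume.restrict (Ioc 0 t)), 0 ≤ w s := by
    filter_upwards [huw] with s hs
    exact (l2Norm_nonneg _).trans hs
  have hW0 : 0 ≤ W := integral_nonneg_of_ae hw0
  set N := 2 * Real.pi * ρ * B * (E * W) with hN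
  have hN0 : 0 ≤ N := by positivity
  obtain ⟨Y, hY0, hY, hYmin⟩ := exists_least_const
    (ι := {f : 𝓢(Rd d, ℂ) // IsBandLimited ρ f})
    (a := fun f => |∫ x, θ₀ x * schwartzRe f.1 x|) (b := fun f => l2Norm f.1)
    (fun _ => l2Norm_nonneg _) ⟨E, hE0, fun f => abs_integral_mul_schwartzRe_le hθ₀ f.1⟩
  obtain ⟨K, hK0, hK, hKmin⟩ := exists_least_const
    (ι := {f : 𝓢(Rd d, ℂ) // IsBandLimited ρ f} × Ioc 0 t)
    (a := fun i => |(∫ x, θ i.2 x * schwartzRe i.1.1 x) - ∫ x, θ₀ x * schwartzRe i.1.1 x|)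
    (b := fun i => l2Norm i.1.1)
    (fun _ => l2Norm_nonneg _) ⟨E + E, by positivity, fun i => by
      refine (abs_sub _ _).trans ?_
      rw [add_mul]
      have h0 := i.2.2.1
      refine add_le_add ((abs_integral_mul_schwartzRe_le (hθ.memLp _ h0.le) i.1.1).trans ?_)
        (abs_integral_mul_schwartzRe_le hθ₀ i.1.1)
      exact mul_le_mul_of_nonneg_right (hE _ h0) (l2Norm_nonneg _)⟩
  -- `K` bounds the change of all pairings up to time `t`, in particular of those with `Δ g`,
  -- so inserting it into the equation yields a new admissible constant
  have hstep : K ≤ 1 / 4 * (Y + K) + N := by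
    refine hKmin _ (by positivity) ?_
    rintro ⟨⟨g, hg⟩, s, hs⟩
    simp only
    have hgn := l2Norm_nonneg g
    have hst : Ioc 0 s ⊆ Ioc 0 t := Ioc_subset_Ioc_right hs.2
    have hUs : ∀ᵐ τ ∂(volume.restrict (Ioc 0 s)), l2Norm (u τ) ≤ U :=
      ae_mono (Measure.restrict_mono hst le_rfl) hU
    rw [hθ.equation_schwartz hκ hu hθ₀ hs.1 hUs, add_sub_cancel_left,
      intervalIntegral.integral_of_le hs.1.le]
    set c := 2 * Real.pi * ρ * (B * l2Norm g) with hc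
    have hc0 : 0 ≤ c := by positivity
    have hfl : ∀ᵐ τ ∂(volume.restrict (Ioc 0 s)), ‖flux κ (θ τ) (u τ) (schwartzRe g)‖
        ≤ κ * ((Y + K) * ((2 * Real.pi * ρ) ^ 2 * l2Norm g)) + c * (E * w τ) := by
      filter_upwards [ae_restrict_mem measurableSet_Ioc, ae_Ioc_of_ae_Ioi hu.memLp,
        ae_mono (Measure.restrict_mono hst le_rfl) huw] with τ hτ h1 h2
      refine (abs_flux_le_pairing hκ (hθ.memLp τ hτ.1.le) h1 _
        (hg.norm_gradient_re_le hρ)).trans ?_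
      simp_rw [laplacian_schwartzRe]
      have k1 := hY ⟨Δ g, hg.laplacian⟩
      have k2 := hK (⟨Δ g, hg.laplacian⟩, ⟨τ, hst hτ⟩)
      simp only at k1 k2
      have k3 : |∫ x, θ τ x * schwartzRe (Δ g) x| ≤ (Y + K) * l2Norm (Δ g : 𝓢(Rd d, ℂ)) := by
        have := abs_sub_abs_le_abs_sub (∫ x, θ τ x * schwartzRe (Δ g) x)
          (∫ x, θ₀ x * schwartzRe (Δ g) x)
        linarith
      have k4 := hg.l2Norm_laplacian_le
      have k5 := hE τ hτ.1
      have k6 := l2Norm_nonneg (u τ)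
      refine add_le_add (mul_le_mul_of_nonneg_left (k3.trans ?_) hκ) ?_
      · gcongr
      · gcongr
    have hws : IntegrableOn w (Ioc 0 s) := hw.mono_set hst
    have hbi : IntegrableOn (fun τ => κ * ((Y + K) * ((2 * Real.pi * ρ) ^ 2 * l2Norm g))
        + c * (E * w τ)) (Ioc 0 s) :=
      (integrable_const _).add ((hws.const_mul E).const_mul c)
    have hle := norm_integral_le_of_norm_le hbi hfl
    rw [Real.norm_eq_abs] at hle
    refine hle.trans ?_
    have hWs : ∫ τ in Ioc 0 s, w τ ≤ W := setIntegral_mono_set hw hw0 hst.eventuallyLE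
    have hconst : ∫ _ in Ioc 0 s, κ * ((Y + K) * ((2 * Real.pi * ρ) ^ 2 * l2Norm g))
        = s * (κ * ((Y + K) * ((2 * Real.pi * ρ) ^ 2 * l2Norm g))) := by
      rw [setIntegral_const, smul_eq_mul, Real.volume_real_Ioc_of_le hs.1.le, sub_zero]
    have hlin : ∫ τ in Ioc 0 s, c * (E * w τ) = c * (E * ∫ τ in Ioc 0 s, w τ) := by
      rw [integral_const_mul, integral_const_mul]
    rw [integral_add (integrable_const _) ((hws.const_mul E).const_mul c), hconst, hlin]
    have e1 : s * (κ * ((Y + K) * ((2 * Real.pi * ρ) ^ 2 * l2Norm g)))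
        ≤ 1 / 4 * (Y + K) * l2Norm g := by
      have : κ * (2 * Real.pi * ρ) ^ 2 * s ≤ 1 / 4 :=
        (mul_le_mul_of_nonneg_left hs.2 (by positivity)).trans hq
      calc _ = κ * (2 * Real.pi * ρ) ^ 2 * s * ((Y + K) * l2Norm g) := by ring
        _ ≤ 1 / 4 * ((Y + K) * l2Norm g) := by gcongr
        _ = _ := by ring
    have e2 : c * (E * ∫ τ in Ioc 0 s, w τ) ≤ N * l2Norm g := by
      calc c * (E * ∫ τ in Ioc 0 s, w τ) ≤ c * (E * W) := by gcongr
        _ = _ := by rw [hc, hN]; ring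
    linarith
  have hYt : Y ≤ l2Norm (θ t) + K := by
    refine hYmin _ (add_nonneg (l2Norm_nonneg _) hK0) ?_
    rintro ⟨g, hg⟩
    have k2 := hK (⟨g, hg⟩, ⟨t, ht, le_rfl⟩)
    have k1 := abs_integral_mul_schwartzRe_le (hθ.memLp t ht.le) g
    simp only at k2 ⊢
    have := abs_sub_abs_le_abs_sub (∫ x, θ₀ x * schwartzRe g x) (∫ x, θ t x * schwartzRe g x)
    rw [abs_sub_comm] at this
    linarith
  have hnY : n₀ ≤ Y := by
    have := hn₀.trans ((le_abs_self _).trans (hY ⟨f, hf⟩))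
    exact le_of_mul_le_mul_right this hf0
  linarith

end LowFrequency

/-! ### Detection of the low-frequency mass of the datum -/

section Pairing

variable {d : ℕ} {θ₀ : Rd d → ℝ}

lemma memLp_fourierL2 (hθ₀ : MemLp θ₀ 2 volume) : MemLp (fourierL2 θ₀ hθ₀) 2 volume :=
  Lp.memLp _

/-- Parseval's identity for the pairing of an `L²` function with a Schwartz function. -/
lemma integral_mul_schwartzRe_eq (hθ₀ : MemLp θ₀ 2 volume) (f : 𝓢(Rd d, ℂ)) :
    ∫ x, θ₀ x * schwartzRe f x = ∫ ξ, (inner ℂ (fourierL2 θ₀ hθ₀ ξ) (𝓕 f ξ)).re := by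
  have hof : MemLp (fun x => (θ₀ x : ℂ)) 2 volume := hθ₀.ofReal
  have h2 : (inner ℂ (𝓕 (hof.toLp) : Lp ℂ 2 (volume : Measure (Rd d)))
      ((𝓕 f : 𝓢(Rd d, ℂ)).toLp 2 volume)).re
      = (inner ℂ hof.toLp (f.toLp 2 volume)).re := by
    rw [← SchwartzMap.toLp_fourier_eq, Lp.inner_fourier_eq]
  rw [L2.inner_def, L2.inner_def] at h2
  have r1 := integral_re (L2.integrable_inner (𝕜 := ℂ) (𝓕 (hof.toLp) : Lp ℂ 2 (volume : Measure (Rd d)))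
      ((𝓕 f : 𝓢(Rd d, ℂ)).toLp 2 volume))
  have r2 := integral_re (L2.integrable_inner (𝕜 := ℂ) hof.toLp (f.toLp 2 volume))
  simp only [RCLike.re_to_complex] at r1 r2
  rw [← r1, ← r2] at h2
  refine Eq.trans ?_ (h2.symm.trans ?_)
  · refine integral_congr_ae ?_
    filter_upwards [f.coeFn_toLp 2 volume, hof.coeFn_toLp] with ξ hξ hξ'
    rw [hξ, hξ', schwartzRe_apply]
    simp [mul_comm]
  · refine integral_congr_ae ?_
    filter_upwards [(𝓕 f : 𝓢(Rd d, ℂ)).coeFn_toLp 2 volume] with ξ hξ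
    rw [hξ]
    rfl

/-- An `L²` function vanishing off a ball is approximated by smooth functions vanishing off the
ball of twice the radius. -/
lemma exists_schwartz_approx {g₀ : Rd d → ℂ} (hg₀ : MemLp g₀ 2 volume) {ρ ε : ℝ} (hρ : 0 < ρ)
    (h0 : ∀ ξ ∉ Metric.closedBall (0 : Rd d) ρ, g₀ ξ = 0) (hε : 0 < ε) :
    ∃ F : 𝓢(Rd d, ℂ), (∀ ξ, 2 * ρ < ‖ξ‖ → F ξ = 0) ∧ l2Norm (fun ξ => g₀ ξ - F ξ) ≤ ε := by
  obtain ⟨g, hgs, hgc, hgε⟩ := hg₀.exist_eLpNorm_sub_le (by simp) one_le_two hε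
  obtain ⟨χ, hχin, hχout⟩ : ∃ χ : ContDiffBump (0 : Rd d), χ.rIn = ρ ∧ χ.rOut = 2 * ρ :=
    ⟨⟨ρ, 2 * ρ, hρ, by linarith⟩, rfl, rfl⟩
  have hχc : HasCompactSupport (fun ξ => χ ξ • g ξ) :=
    hgs.mono fun ξ hξ h => hξ (by simp [h])
  have hχs : ContDiff ℝ ∞ (fun ξ => χ ξ • g ξ) := χ.contDiff.smul hgc
  obtain ⟨F, hF⟩ : ∃ F : 𝓢(Rd d, ℂ), ∀ ξ, F ξ = χ ξ • g ξ :=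
    ⟨hχc.toSchwartzMap hχs, hχc.toSchwartzMap_toFun hχs⟩
  have hle : eLpNorm (fun ξ => g₀ ξ - F ξ) 2 volume ≤ eLpNorm (g₀ - g) 2 volume := by
    refine eLpNorm_mono fun ξ => ?_
    rw [hF, Pi.sub_apply]
    by_cases hξ : ξ ∈ Metric.closedBall (0 : Rd d) ρ
    · rw [χ.one_of_mem_closedBall (by rwa [hχin]), one_smul]
    · rw [h0 ξ hξ, zero_sub, zero_sub, norm_neg, norm_neg, norm_smul,
        Real.norm_of_nonneg χ.nonneg]
      exact mul_le_of_le_one_left (norm_nonneg _) χ.le_one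
  refine ⟨F, fun ξ hξ => ?_, ENNReal.toReal_le_of_le_ofReal hε.le (hle.trans hgε)⟩
  rw [hF, χ.zero_of_le_dist (by simpa [hχout] using hξ.le), zero_smul]

/-- The restriction of a function to a set is detected by any good approximation of it. -/
lemma le_integral_inner_re {G g₀ F : Rd d → ℂ} (hG : MemLp G 2 volume) (hF : MemLp F 2 volume)
    {B : Set (Rd d)} (hB : MeasurableSet B) (hg₀ : g₀ = B.indicator G) :
    l2Norm g₀ ^ 2 - l2Norm G * l2Norm (fun ξ => g₀ ξ - F ξ)
      ≤ ∫ ξ, (inner ℂ (G ξ) (F ξ)).re := by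
  have hg₀L : MemLp g₀ 2 volume := hg₀ ▸ hG.indicator hB
  have hD : MemLp (fun ξ => g₀ ξ - F ξ) 2 volume := hg₀L.sub hF
  have iA : Integrable (fun ξ => ‖g₀ ξ‖ ^ 2) := hg₀L.integrable_norm_pow (by norm_num)
  have iB := integrable_norm_mul_norm hG hD
  have iC : Integrable (fun ξ => (inner ℂ (G ξ) (F ξ)).re) := by
    refine (integrable_norm_mul_norm hG hF).mono'
      (Complex.continuous_re.comp_aestronglyMeasurable (hG.1.inner hF.1))
      (Eventually.of_forall fun ξ => ?_)
    exact (Complex.abs_re_le_norm _).trans (norm_inner_le_norm _ _)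
  have hpt : ∀ ξ, ‖g₀ ξ‖ ^ 2 - ‖G ξ‖ * ‖g₀ ξ - F ξ‖ ≤ (inner ℂ (G ξ) (F ξ)).re := by
    intro ξ
    have h1 : inner ℂ (G ξ) (F ξ) = inner ℂ (G ξ) (g₀ ξ) - inner ℂ (G ξ) (g₀ ξ - F ξ) := by
      rw [← inner_sub_right]; simp
    have h2 : (inner ℂ (G ξ) (g₀ ξ)).re = ‖g₀ ξ‖ ^ 2 := by
      by_cases hξ : ξ ∈ B
      · simp only [hg₀, indicator_of_mem hξ]
        rw [inner_self_eq_norm_sq_to_K]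
        norm_cast
      · simp [hg₀, indicator_of_notMem hξ]
    have h3 := (Complex.re_le_norm _).trans (norm_inner_le_norm (𝕜 := ℂ) (G ξ) (g₀ ξ - F ξ))
    rw [h1, Complex.sub_re, h2]
    linarith
  have h1 := integral_mono (iA.sub iB) iC hpt
  have h2 := integral_norm_mul_norm_le hG hD
  simp only [Pi.sub_apply] at h1
  rw [integral_sub iA iB, ← l2Norm_sq hg₀L] at h1
  change _ ≤ l2Norm G * l2Norm (fun ξ => g₀ ξ - F ξ) at h2
  linarith

/-- The low-frequency part of an `L²` function is detected by band-limited test functions. -/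
lemma exists_bandLimited_pairing (hθ₀ : MemLp θ₀ 2 volume) {ρ n₀ : ℝ} (hρ : 0 < ρ) (hn₀ : 0 < n₀)
    (hn : n₀ ^ 2 = ∫ ξ in Metric.closedBall (0 : Rd d) ρ, ‖fourierL2 θ₀ hθ₀ ξ‖ ^ 2) :
    ∃ f : 𝓢(Rd d, ℂ), IsBandLimited (2 * ρ) f ∧ 0 < l2Norm f ∧
      n₀ / 2 * l2Norm f ≤ ∫ x, θ₀ x * schwartzRe f x := by
  have hG := memLp_fourierL2 hθ₀
  generalize hGdef : fourierL2 θ₀ hθ₀ = G at hn hG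
  have hBm : MeasurableSet (Metric.closedBall (0 : Rd d) ρ) :=
    Metric.isClosed_closedBall.measurableSet
  obtain ⟨g₀, hg₀⟩ : ∃ g₀, g₀ = (Metric.closedBall (0 : Rd d) ρ).indicator G := ⟨_, rfl⟩
  have hg₀L : MemLp g₀ 2 volume := hg₀ ▸ hG.indicator hBm
  have hg₀n : l2Norm g₀ = n₀ := by
    have : l2Norm g₀ ^ 2 = n₀ ^ 2 := by
      rw [l2Norm_sq hg₀L, hn, ← integral_indicator hBm]
      congr 1; ext ξ
      by_cases hξ : ξ ∈ Metric.closedBall (0 : Rd d) ρ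
      · rw [hg₀, indicator_of_mem hξ, indicator_of_mem hξ]
      · rw [hg₀, indicator_of_notMem hξ, indicator_of_notMem hξ]; simp
    exact (pow_left_inj₀ (l2Norm_nonneg _) hn₀.le two_ne_zero).1 this
  have hl0 : 0 ≤ l2Norm G := l2Norm_nonneg _
  -- `ε` is so small that `‖G‖₂ ε ≤ n₀² / 4` and `ε ≤ n₀ / 4`
  obtain ⟨ε, hε⟩ : ∃ ε, ε = n₀ ^ 2 / (4 * (l2Norm G + n₀)) := ⟨_, rfl⟩
  have hε0 : 0 < ε := by rw [hε]; positivity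
  have hε1 : l2Norm G * ε ≤ n₀ ^ 2 / 4 := by
    rw [hε, mul_div_assoc', div_le_div_iff₀ (by positivity) (by positivity)]
    nlinarith [sq_nonneg n₀, mul_pos (pow_pos hn₀ 2) hn₀]
  have hε2 : ε ≤ n₀ / 4 := by
    rw [hε, div_le_div_iff₀ (by positivity) (by positivity)]
    nlinarith [mul_nonneg hn₀.le hl0]
  obtain ⟨F, hFs, hFε⟩ := exists_schwartz_approx hg₀L hρ
    (fun ξ hξ => by rw [hg₀, indicator_of_notMem hξ]) hε0
  have hFL : MemLp F 2 volume := F.memLp 2 volume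
  have hD : MemLp (fun ξ => g₀ ξ - F ξ) 2 volume := hg₀L.sub hFL
  have hFn : l2Norm F ≤ n₀ + ε := by
    have h1 : eLpNorm F 2 volume ≤ eLpNorm g₀ 2 volume + eLpNorm (fun ξ => g₀ ξ - F ξ) 2 volume := by
      have : (F : Rd d → ℂ) = g₀ - fun ξ => g₀ ξ - F ξ := by ext; simp
      conv_lhs => rw [this]
      exact eLpNorm_sub_le hg₀L.1 hD.1 one_le_two
    have h2 := ENNReal.toReal_mono (ENNReal.add_ne_top.2 ⟨hg₀L.2.ne, hD.2.ne⟩) h1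
    rw [ENNReal.toReal_add hg₀L.2.ne hD.2.ne] at h2
    change l2Norm F ≤ l2Norm g₀ + l2Norm (fun ξ => g₀ ξ - F ξ) at h2
    linarith
  obtain ⟨f, hf⟩ : ∃ f : 𝓢(Rd d, ℂ), 𝓕 f = F :=
    ⟨𝓕⁻ F, FourierTransform.fourier_fourierInv_eq F⟩
  have hlf : l2Norm f = l2Norm F := by rw [← l2Norm_fourier_schwartz, hf]
  have hmain := le_integral_inner_re hG hFL hBm hg₀
  have hpair : ∫ x, θ₀ x * schwartzRe f x = ∫ ξ, (inner ℂ (G ξ) (F ξ)).re := by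
    rw [integral_mul_schwartzRe_eq hθ₀, hf, hGdef]
  have hlow : n₀ ^ 2 - n₀ ^ 2 / 4 ≤ ∫ x, θ₀ x * schwartzRe f x := by
    rw [hpair]
    refine le_trans ?_ hmain
    rw [hg₀n]
    have := mul_le_mul_of_nonneg_left hFε hl0
    linarith
  have hsq : 0 < n₀ ^ 2 := by positivity
  refine ⟨f, fun ξ hξ => by rw [hf]; exact hFs ξ hξ, ?_, ?_⟩
  · by_contra hcon
    have h0 : l2Norm f = 0 := le_antisymm (not_lt.1 hcon) (l2Norm_nonneg _)
    have := (le_abs_self _).trans (abs_integral_mul_schwartzRe_le hθ₀ f)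
    rw [h0, mul_zero] at this
    linarith
  · have h1 : n₀ / 2 * l2Norm f ≤ n₀ / 2 * (n₀ + n₀ / 4) := by gcongr; linarith
    nlinarith

end Pairing

/-! ### The diffusive frequency scale -/

section Scaling

variable {d : ℕ}

lemma TimeLarge.rpow_le {r α κ m t : ℝ} (h : TimeLarge d r α κ m t) :
    (1 + t) ^ (-min (α - (r + 1) / 2) (1 - r)) ≤ κ ^ (m + 1 / 2 - (d : ℝ) / 4 - r) := by
  rcases h with ⟨h1, h2⟩ | ⟨-, h1, h2⟩
  · rwa [min_eq_right (by linarith), neg_sub]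
  · rw [min_eq_left (by linarith)]
    convert h2 using 2
    ring

/-- If `x ^ (-b) ≤ κ ^ p`, then `κ x` is at least the power `1 - b / p` of `x`. -/
lemma rpow_le_mul_of_rpow_neg_le {κ x b p : ℝ} (hκ : 0 < κ) (hx : 0 < x) (hp : 0 < p)
    (h : x ^ (-b) ≤ κ ^ p) : x ^ (1 - b / p) ≤ κ * x := by
  have h1 : x ^ (-(b / p)) ≤ κ := by
    have := Real.rpow_le_rpow (Real.rpow_nonneg hx.le _) h (inv_nonneg.2 hp.le)
    rwa [← Real.rpow_mul hx.le, Real.rpow_rpow_inv hκ.le hp.ne', neg_mul,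
      ← div_eq_mul_inv] at this
  rw [sub_eq_neg_add, Real.rpow_add hx, Real.rpow_one]
  gcongr

lemma integral_one_add_rpow_le {a t : ℝ} (ha : a < 1) (ht : 0 < t) :
    ∫ s in Ioc 0 t, (1 + s) ^ (-a) ≤ (1 + t) ^ (1 - a) / (1 - a) := by
  rw [← intervalIntegral.integral_of_le ht.le,
    intervalIntegral.integral_comp_add_left (fun s => s ^ (-a)) 1,
    integral_rpow (Or.inl (by linarith)), neg_add_eq_sub, add_zero, Real.one_rpow]
  have : 0 < 1 - a := by linarith
  gcongr
  linarith

lemma continuousOn_one_add_rpow (a t : ℝ) :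
    ContinuousOn (fun s : ℝ => (1 + s) ^ (-a)) (Icc 0 t) :=
  ContinuousOn.rpow_const (by fun_prop) fun s hs => Or.inl (by linarith [hs.1])

lemma HasDecayCharacter.exists_le {θ₀ : Rd d → ℝ} {hθ₀ : MemLp θ₀ 2 volume} {r : ℝ}
    (h : HasDecayCharacter θ₀ hθ₀ r) :
    ∃ l : ℝ, 0 < l ∧ ∀ᶠ δ in 𝓝[>] (0 : ℝ), (l * δ ^ ((d : ℝ) / 2 + r)) ^ 2 ≤
      ∫ ξ in Metric.closedBall (0 : Rd d) δ, ‖fourierL2 θ₀ hθ₀ ξ‖ ^ 2 := by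
  obtain ⟨-, L, hL, hlim⟩ := h
  refine ⟨√(L / 2), by positivity, ?_⟩
  filter_upwards [hlim.eventually (lt_mem_nhds (half_lt_self hL)), self_mem_nhdsWithin]
    with δ hδ hδ0
  have hδ0 : 0 < δ := hδ0
  have h1 : (δ ^ ((d : ℝ) / 2 + r)) ^ 2 * δ ^ (-2 * r - (d : ℝ)) = 1 := by
    rw [← Real.rpow_natCast, ← Real.rpow_mul hδ0.le, ← Real.rpow_add hδ0]
    convert Real.rpow_zero δ using 2
    push_cast; ring
  have h2 : 0 < (δ ^ ((d : ℝ) / 2 + r)) ^ 2 := by positivity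
  rw [mul_pow, Real.sq_sqrt (by positivity), mul_comm]
  calc (δ ^ ((d : ℝ) / 2 + r)) ^ 2 * (L / 2)
      ≤ (δ ^ ((d : ℝ) / 2 + r)) ^ 2 * (δ ^ (-2 * r - (d : ℝ)) *
          ∫ ξ in Metric.closedBall (0 : Rd d) δ, ‖fourierL2 θ₀ hθ₀ ξ‖ ^ 2) := by gcongr
    _ = _ := by rw [← mul_assoc, h1, one_mul]

lemma sqrt_volume_closedBall {ρ : ℝ} (hρ : 0 ≤ ρ) :
    √(volume.real (Metric.closedBall (0 : Rd d) ρ))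
      = ρ ^ ((d : ℝ) / 2) * √(volume.real (Metric.ball (0 : Rd d) 1)) := by
  rw [Measure.real, Measure.addHaar_closedBall _ _ hρ, ENNReal.toReal_mul,
    ENNReal.toReal_ofReal (by positivity), Real.sqrt_mul (by positivity), finrank_euclideanSpace_fin,
    Real.sqrt_eq_rpow, ← Real.rpow_natCast, ← Real.rpow_mul hρ]
  congr 2
  ring

variable {u : ℝ → Rd d → Rd d} {α A : ℝ}

lemma HasEnergyDecay.ae_le (h : HasEnergyDecay u α A) {a : ℝ} (ha : a ≤ α) :
    ∀ᵐ s ∂(volume.restrict (Ioi (0 : ℝ))), l2Norm (u s) ≤ |A| * (1 + s) ^ (-a) := by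
  obtain ⟨_, -, h⟩ := h
  filter_upwards [h, ae_restrict_mem measurableSet_Ioi] with s hs hs0
  have hs0 : (0 : ℝ) < s := hs0
  refine hs.2.trans (mul_le_mul (le_abs_self _) ?_ (by positivity) (abs_nonneg _))
  exact Real.rpow_le_rpow_of_exponent_le (by linarith) (by linarith)

lemma HasEnergyDecay.exists_bound (h : HasEnergyDecay u α A) (T : ℝ) :
    ∃ U, ∀ᵐ s ∂(volume.restrict (Ioc 0 T)), l2Norm (u s) ≤ U := by
  obtain ⟨U, hU⟩ := isCompact_Icc.exists_bound_of_continuousOn (continuousOn_one_add_rpow α T)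
  refine ⟨|A| * U, ?_⟩
  filter_upwards [ae_Ioc_of_ae_Ioi (h.ae_le le_rfl), ae_restrict_mem measurableSet_Ioc]
    with s hs hst
  exact hs.trans (mul_le_mul_of_nonneg_left
    ((le_abs_self _).trans (hU s (Ioc_subset_Icc_self hst))) (abs_nonneg _))

end Scaling

section LowerBound

variable {d : ℕ} {u : ℝ → Rd d → Rd d} {θ : ℝ → Rd d → ℝ} {θ₀ : Rd d → ℝ} {κ α A r : ℝ}

/-- The lower bound at the diffusive frequency scale `ρ = ε (κ (1 + t)) ^ (-1 / 2)`: for small `ε`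
the low-frequency mass of the datum, of size `ρ ^ (d / 2 + r)`, dominates the transport term. -/
lemma IsWeakSolution.rpow_le_l2Norm (hκ : 0 < κ) (hu : IsVelocityField u)
    (hα : HasEnergyDecay u α A) (hθ : IsWeakSolution κ u θ₀ θ) (hθ₀ : MemLp θ₀ 2 volume)
    {t a ε l : ℝ} (ht : 0 < t) (haα : a ≤ α) (ha : a < 1) (hε : 0 < ε) (hl : 0 < l)
    (hκt : (1 + t) ^ (1 - a) ≤ (κ * (1 + t)) ^ ((1 - r) / 2))
    (hεπ : 8 * Real.pi * ε ≤ 1)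
    (hdc : (l * (ε * (κ * (1 + t)) ^ (-1 / 2 : ℝ)) ^ ((d : ℝ) / 2 + r)) ^ 2 ≤
      ∫ ξ in Metric.closedBall (0 : Rd d) (ε * (κ * (1 + t)) ^ (-1 / 2 : ℝ)),
        ‖fourierL2 θ₀ hθ₀ ξ‖ ^ 2)
    (hεl : 16 / 3 * Real.pi * 2 ^ ((d : ℝ) / 2) * √(volume.real (Metric.ball (0 : Rd d) 1)) *
      l2Norm θ₀ * (|A| / (1 - a)) * ε ^ (1 - r) ≤ l / 6) :
    l / 6 * ε ^ ((d : ℝ) / 2 + r) * κ ^ (-(d : ℝ) / 4 - r / 2) * (1 + t) ^ (-(d : ℝ) / 4 - r / 2)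
      ≤ l2Norm (θ t) := by
  have hπ := Real.pi_pos
  have hx : 0 < 1 + t := by linarith
  obtain ⟨y, hy⟩ : ∃ y, y = κ * (1 + t) := ⟨_, rfl⟩
  have hy0 : 0 < y := hy ▸ by positivity
  rw [← hy] at hκt hdc
  obtain ⟨ρ, hρ⟩ : ∃ ρ, ρ = ε * y ^ (-1 / 2 : ℝ) := ⟨_, rfl⟩
  have hρ0 : 0 < ρ := hρ ▸ by positivity
  rw [← hρ] at hdc
  set P := ∫ ξ in Metric.closedBall (0 : Rd d) ρ, ‖fourierL2 θ₀ hθ₀ ξ‖ ^ 2 with hP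
  have hn₀ : l * ρ ^ ((d : ℝ) / 2 + r) ≤ √P := Real.le_sqrt_of_sq_le hdc
  have hn₀' : 0 < √P := lt_of_lt_of_le (by positivity) hn₀
  obtain ⟨f, hf, hf0, hfP⟩ := exists_bandLimited_pairing hθ₀ hρ0 hn₀'
    (Real.sq_sqrt ((sq_nonneg _).trans hdc))
  have hρ2 : ρ ^ 2 * y = ε ^ 2 := by
    rw [hρ, mul_pow, mul_assoc, ← Real.rpow_natCast (y ^ (-1 / 2 : ℝ)), ← Real.rpow_mul hy0.le]
    norm_num
    rw [Real.rpow_neg_one, inv_mul_cancel₀ hy0.ne', mul_one]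
  have hq : κ * (2 * Real.pi * (2 * ρ)) ^ 2 * t ≤ 1 / 4 := by
    have h1 : κ * t ≤ y := by rw [hy]; nlinarith
    calc κ * (2 * Real.pi * (2 * ρ)) ^ 2 * t = 16 * Real.pi ^ 2 * (ρ ^ 2 * (κ * t)) := by ring
      _ ≤ 16 * Real.pi ^ 2 * (ρ ^ 2 * y) := by gcongr
      _ = (8 * Real.pi * ε) ^ 2 / 4 := by rw [hρ2]; ring
      _ ≤ 1 ^ 2 / 4 := by gcongr
      _ = 1 / 4 := by norm_num
  obtain ⟨U, hU⟩ := hα.exists_bound t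
  have hE : ∀ s, 0 < s → l2Norm (θ s) ≤ l2Norm θ₀ := fun s hs =>
    hθ.l2Norm_le hκ.le hu hα.exists_bound hθ₀ hs
  have hwi : IntegrableOn (fun s : ℝ => |A| * (1 + s) ^ (-a)) (Ioc 0 t) :=
    (((continuousOn_one_add_rpow a t).integrableOn_Icc).mono_set Ioc_subset_Icc_self).const_mul _
  have hmain := hθ.low_frequency_lower_bound hκ.le hu hθ₀ ht hU hwi
    (ae_Ioc_of_ae_Ioi (hα.ae_le haα)) hE (by positivity) hq hf hf0 hfP
  have hW : ∫ s in Ioc 0 t, |A| * (1 + s) ^ (-a) ≤ |A| / (1 - a) * y ^ ((1 - r) / 2) := by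
    rw [integral_const_mul]
    calc |A| * ∫ s in Ioc 0 t, (1 + s) ^ (-a) ≤ |A| * ((1 + t) ^ (1 - a) / (1 - a)) := by
          gcongr; exact integral_one_add_rpow_le ha ht
      _ = |A| / (1 - a) * (1 + t) ^ (1 - a) := by ring
      _ ≤ _ := by
          have : 0 < 1 - a := by linarith
          gcongr
  have hyρ : ρ * ρ ^ ((d : ℝ) / 2) * y ^ ((1 - r) / 2) = ε ^ (1 - r) * ρ ^ ((d : ℝ) / 2 + r) := by
    have h1 : ρ ^ (1 - r) * y ^ ((1 - r) / 2) = ε ^ (1 - r) := by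
      rw [hρ, Real.mul_rpow hε.le (by positivity), ← Real.rpow_mul hy0.le, mul_assoc,
        ← Real.rpow_add hy0]
      have : -1 / 2 * (1 - r) + (1 - r) / 2 = 0 := by ring
      rw [this, Real.rpow_zero, mul_one]
    have h2 : ρ * ρ ^ ((d : ℝ) / 2) = ρ ^ (1 - r) * ρ ^ ((d : ℝ) / 2 + r) := by
      rw [← Real.rpow_add hρ0]
      nth_rw 1 [← Real.rpow_one ρ]
      rw [← Real.rpow_add hρ0]
      congr 1; ring
    rw [h2, ← h1]; ring
  have hE0 := l2Norm_nonneg θ₀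
  have hN : 4 / 3 * (2 * Real.pi * (2 * ρ) * √(volume.real (Metric.closedBall (0 : Rd d) (2 * ρ))) *
      (l2Norm θ₀ * ∫ s in Ioc 0 t, |A| * (1 + s) ^ (-a))) ≤ l / 6 * ρ ^ ((d : ℝ) / 2 + r) := by
    rw [sqrt_volume_closedBall (by positivity), Real.mul_rpow two_pos.le hρ0.le]
    calc _ ≤ 4 / 3 * (2 * Real.pi * (2 * ρ) * (2 ^ ((d : ℝ) / 2) * ρ ^ ((d : ℝ) / 2) *
          √(volume.real (Metric.ball (0 : Rd d) 1))) *
          (l2Norm θ₀ * (|A| / (1 - a) * y ^ ((1 - r) / 2)))) := by gcongr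
      _ = 16 / 3 * Real.pi * 2 ^ ((d : ℝ) / 2) * √(volume.real (Metric.ball (0 : Rd d) 1)) *
          l2Norm θ₀ * (|A| / (1 - a)) * (ρ * ρ ^ ((d : ℝ) / 2) * y ^ ((1 - r) / 2)) := by ring
      _ = 16 / 3 * Real.pi * 2 ^ ((d : ℝ) / 2) * √(volume.real (Metric.ball (0 : Rd d) 1)) *
          l2Norm θ₀ * (|A| / (1 - a)) * ε ^ (1 - r) * ρ ^ ((d : ℝ) / 2 + r) := by rw [hyρ]; ring
      _ ≤ _ := by gcongr
  have hfin : l / 6 * ε ^ ((d : ℝ) / 2 + r) * κ ^ (-(d : ℝ) / 4 - r / 2)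
      * (1 + t) ^ (-(d : ℝ) / 4 - r / 2) = l / 6 * ρ ^ ((d : ℝ) / 2 + r) := by
    rw [mul_assoc _ (κ ^ _), ← Real.mul_rpow hκ.le hx.le, ← hy, hρ,
      Real.mul_rpow hε.le (by positivity), ← Real.rpow_mul hy0.le, mul_assoc]
    congr 4; ring
  rw [hfin]
  linarith

end LowerBound

end AdvDiff

end

theorem theorem1 (d : ℕ) (hd : d = 2 ∨ d = 3)
    (θ₀ : AdvDiff.Rd d → ℝ) (hθ₀ : MemLp θ₀ 2 volume)
    (r : ℝ) (hr : AdvDiff.HasDecayCharacter θ₀ hθ₀ r) (hr_lower : -(d : ℝ) / 2 < r) (hr_upper : r < 1)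
    (α : ℝ) (hα : r / 2 + 1 / 2 < α) (A : ℝ) :
    ∃ C : ℝ, 0 < C ∧
      ∀ κ : ℝ, 0 < κ →
      ∀ u : ℝ → AdvDiff.Rd d → AdvDiff.Rd d, AdvDiff.IsVelocityField u →
        AdvDiff.HasEnergyDecay u α A →
      ∀ θ : ℝ → AdvDiff.Rd d → ℝ, AdvDiff.IsWeakSolution κ u θ₀ θ →
      ∀ t : ℝ, 0 < t →
        (∃ m : ℚ, (d : ℚ) + 2 ≤ m ∧ AdvDiff.TimeLarge d r α κ (m : ℝ) t) →
        C * κ ^ (-(d : ℝ) / 4 - r / 2) * (1 + t) ^ (-(d : ℝ) / 4 - r / 2) ≤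
          AdvDiff.l2Norm (θ t) := by
  obtain ⟨l, hl, hdc⟩ := hr.exists_le
  obtain ⟨δ₀, hδ₀, hδ⟩ := mem_nhdsGT_iff_exists_Ioo_subset.1 hdc
  have hδ₀ : 0 < δ₀ := hδ₀
  -- `b` is the exponent in the largeness condition; `u` is treated as decaying at the rate
  -- `a ≤ α`, which is kept away from `1` so that the time integral of its norm stays a power
  obtain ⟨b, hb⟩ : ∃ b, b = min (α - (r + 1) / 2) (1 - r) := ⟨_, rfl⟩
  have hb0 : 0 < b := hb ▸ lt_min (by linarith) (by linarith)
  have hb1 : b ≤ α - (r + 1) / 2 := hb ▸ min_le_left _ _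
  have hb2 : b ≤ 1 - r := hb ▸ min_le_right _ _
  obtain ⟨a, ha⟩ : ∃ a, a = (r + 1) / 2 + min b ((1 - r) / 4) := ⟨_, rfl⟩
  have haα : a ≤ α := by linarith [min_le_left b ((1 - r) / 4)]
  have ha1 : a < 1 := by linarith [min_le_right b ((1 - r) / 4)]
  set M := 16 / 3 * Real.pi * 2 ^ ((d : ℝ) / 2) *
    √(volume.real (Metric.ball (0 : AdvDiff.Rd d) 1)) * AdvDiff.l2Norm θ₀ * (|A| / (1 - a)) with hM
  have hMlim : Tendsto (fun ε : ℝ => M * ε ^ (1 - r)) (𝓝[>] 0) (𝓝 0) := by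
    have h1 : ContinuousAt (fun ε : ℝ => M * ε ^ (1 - r)) 0 :=
      (Real.continuousAt_rpow_const _ _ (Or.inr (by linarith))).const_mul M
    have h2 := h1.tendsto
    rw [Real.zero_rpow (by linarith), mul_zero] at h2
    exact h2.mono_left nhdsWithin_le_nhds
  obtain ⟨ε, hεM, hε0, hεδ, hεπ⟩ : ∃ ε, M * ε ^ (1 - r) < l / 6 ∧ 0 < ε ∧ ε < δ₀ ∧
      ε < 1 / (8 * Real.pi) := by
    have h1 : ∀ᶠ ε in 𝓝[>] (0 : ℝ), M * ε ^ (1 - r) < l / 6 :=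
      hMlim.eventually (gt_mem_nhds (by positivity))
    have h2 : ∀ᶠ ε in 𝓝[>] (0 : ℝ), 0 < ε := self_mem_nhdsWithin
    have h3 : ∀ c > 0, ∀ᶠ ε in 𝓝[>] (0 : ℝ), ε < c := fun c hc =>
      nhdsWithin_le_nhds (gt_mem_nhds hc)
    exact (h1.and (h2.and ((h3 δ₀ hδ₀).and (h3 _ (by positivity))))).exists
  refine ⟨l / 6 * ε ^ ((d : ℝ) / 2 + r), by positivity, ?_⟩
  rintro κ hκ u hu huA θ hθ t ht ⟨m, hm, hmt⟩
  have hx : 1 ≤ 1 + t := by linarith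
  obtain ⟨p, hp⟩ : ∃ p, p = (m : ℝ) + 1 / 2 - (d : ℝ) / 4 - r := ⟨_, rfl⟩
  have hm' : (d : ℝ) + 2 ≤ m := by exact_mod_cast hm
  have hd0 : (0 : ℝ) ≤ d := Nat.cast_nonneg d
  -- this is where `m ≥ d + 2` and `r > -d / 2` enter
  have hp2 : 2 * (1 - r) ≤ p := by linarith
  have hp0 : 0 < p := by linarith
  have hbp : b / p ≤ 1 := (div_le_one hp0).2 (by linarith)
  have hy : (1 + t) ^ (1 - b / p) ≤ κ * (1 + t) :=
    AdvDiff.rpow_le_mul_of_rpow_neg_le hκ (by linarith) hp0 (by rw [hb, hp]; exact hmt.rpow_le)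
  have hy1 : 1 ≤ κ * (1 + t) := (Real.one_le_rpow hx (by linarith)).trans hy
  -- the power of `1 + t` lost by passing from `1 + t` to `κ (1 + t)` is paid by the margin of `a`
  -- over the critical rate `(r + 1) / 2`
  have hexp : (1 - r) / 2 * (b / p) ≤ min b ((1 - r) / 4) := by
    refine le_min ?_ ?_
    · rw [mul_div_assoc', div_le_iff₀ hp0, mul_comm]
      exact mul_le_mul_of_nonneg_left (by linarith) hb0.le
    · have : b / p ≤ 1 / 2 := (div_le_iff₀ hp0).2 (by linarith)
      have := mul_le_mul_of_nonneg_left this (by linarith : 0 ≤ (1 - r) / 2)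
      linarith
  have hκt : (1 + t) ^ (1 - a) ≤ (κ * (1 + t)) ^ ((1 - r) / 2) :=
    calc (1 + t) ^ (1 - a) ≤ (1 + t) ^ ((1 - b / p) * ((1 - r) / 2)) :=
          Real.rpow_le_rpow_of_exponent_le hx (by linarith)
      _ = ((1 + t) ^ (1 - b / p)) ^ ((1 - r) / 2) := Real.rpow_mul (by linarith) _ _
      _ ≤ _ := Real.rpow_le_rpow (by positivity) hy (by linarith)
  have hρ1 : (κ * (1 + t)) ^ (-1 / 2 : ℝ) ≤ 1 :=
    Real.rpow_le_one_of_one_le_of_nonpos hy1 (by norm_num)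
  have hρ0 : 0 < (κ * (1 + t)) ^ (-1 / 2 : ℝ) := by positivity
  refine hθ.rpow_le_l2Norm hκ hu huA hθ₀ ht haα ha1 hε0 hl hκt ?_ (hδ ⟨by positivity, ?_⟩) hεM.le
  · rw [lt_div_iff₀ (by positivity)] at hεπ
    linarith
  · exact (mul_le_of_le_one_right hε0.le hρ1).trans_lt hεδ
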